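/- Let $(M^n,g)$ be a smooth Riemannian manifold, with Levi-Civita connection $D$, and let $f\in C^\infty(M)$ be such that $(M,g,f)$ is an expanding gradient soliton, that is, with $X=\nabla f$, $$2\,\mathrm{Ric}_g+g=\mathscr L_X g .$$ Let $\Delta$ denote the connection (rough) Laplacian $\Delta=-\nabla^*\nabla$ on tensor fields, and, for a $(0,2)$-tensor $h$, define the Lichnerowicz Laplacian in an orthonormal frame $\{e_1,\dots,e_n\}$ of $T_pM$ by $$(\Delta_L h)(e_i,e_k)=(\Delta h)(e_i,e_k)+2\sum_{j,l=1}^n R(e_i,e_j,e_k,e_l)\,h(e_j,e_l)-h(\mathrm{Ric}(e_i),e_k)-h(e_i,\mathrm{Ric}(e_k)),$$ where the sign of the curvature tensor is such that $R(u,v,u,v)$ is the sectional curvature of the plane spanned by orthonormal $u,v$, and $\mathrm{Ric}(e_i)$ is the vector dual to $\mathrm{Ric}(e_i,\cdot)$. If $W$ is a smooth vector field on $M$ with $$\Delta W+D_XW-\tfrac12 W=0,$$ then the $(0,2)$-tensor $h=\mathscr L_W g$ satisfies $$\Delta_L h+\mathscr L_X h-h=0 .$$ -/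

import Mathlib

open scoped Manifold ContDiff

noncomputable section

namespace RicciSoliton

/-! ### Tensor calculus in coordinates

Below `U ⊆ ℝⁿ` is the image of a coordinate chart.  Objects are given by their component functions:
a function by `φ : ℝⁿ → ℝ`, a vector field by `W : ℝⁿ → Fin n → ℝ` (components `Wᵏ`), a
`(0,2)`-tensor by `h : ℝⁿ → Matrix (Fin n) (Fin n) ℝ` (components `h i j`); `G` is the metric.
Only the values near the point of evaluation matter. -/

section Coordinates

variable {n : ℕ}

/-- The partial derivative `∂ᵢ φ`. -/
def pderiv (i : Fin n) (φ : EuclideanSpace ℝ (Fin n) → ℝ) (y : EuclideanSpace ℝ (Fin n)) : ℝ :=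
  fderiv ℝ φ y (EuclideanSpace.single i 1)

/-- The Christoffel symbols `Γᵏᵢⱼ = ½ gᵏˡ (∂ᵢ gⱼₗ + ∂ⱼ gᵢₗ - ∂ₗ gᵢⱼ)` of the Levi-Civita
connection, `D_{∂ᵢ} ∂ⱼ = Γᵏᵢⱼ ∂ₖ`; the order of the arguments is `k i j`. -/
def christoffel (G : EuclideanSpace ℝ (Fin n) → Matrix (Fin n) (Fin n) ℝ)
    (y : EuclideanSpace ℝ (Fin n)) (k i j : Fin n) : ℝ :=
  (1 / 2 : ℝ) * ∑ l, (G y)⁻¹ k l *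
    (pderiv i (fun z => G z j l) y + pderiv j (fun z => G z i l) y - pderiv l (fun z => G z i j) y)

/-- The components of the curvature tensor of type `(1,3)`: `riemannUp G y m l i j` is the
`∂ₘ`-component of `D_{∂ᵢ} D_{∂ⱼ} ∂ₗ - D_{∂ⱼ} D_{∂ᵢ} ∂ₗ`. -/
def riemannUp (G : EuclideanSpace ℝ (Fin n) → Matrix (Fin n) (Fin n) ℝ)
    (y : EuclideanSpace ℝ (Fin n)) (m l i j : Fin n) : ℝ :=
  pderiv i (fun z => christoffel G z m j l) y - pderiv j (fun z => christoffel G z m i l) y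
    + ∑ p, (christoffel G y m i p * christoffel G y p j l
      - christoffel G y m j p * christoffel G y p i l)

/-- The components `R(∂ᵢ, ∂ⱼ, ∂ₖ, ∂ₗ)` of the curvature tensor of type `(0,4)`, with the sign
convention for which `R(u, v, u, v)` is the sectional curvature of an orthonormal pair `u, v`. -/
def riemann (G : EuclideanSpace ℝ (Fin n) → Matrix (Fin n) (Fin n) ℝ)
    (y : EuclideanSpace ℝ (Fin n)) (i j k l : Fin n) : ℝ :=
  ∑ m, G y k m * riemannUp G y m l i j

/-- The Ricci tensor `Ricᵢₖ = gʲˡ R(∂ᵢ, ∂ⱼ, ∂ₖ, ∂ₗ)`. -/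
def ricci (G : EuclideanSpace ℝ (Fin n) → Matrix (Fin n) (Fin n) ℝ)
    (y : EuclideanSpace ℝ (Fin n)) (i k : Fin n) : ℝ :=
  ∑ j, ∑ l, (G y)⁻¹ j l * riemann G y i j k l

/-- The Ricci endomorphism `Ric(∂ᵢ) = Ricᵖᵢ ∂ₚ`, `Ricᵖᵢ = gᵖᵠ Ricᵢᵩ`; the order of the arguments
is `p i`. -/
def ricciEndo (G : EuclideanSpace ℝ (Fin n) → Matrix (Fin n) (Fin n) ℝ)
    (y : EuclideanSpace ℝ (Fin n)) (p i : Fin n) : ℝ :=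
  ∑ q, (G y)⁻¹ p q * ricci G y i q

/-- The gradient `(∇φ)ⁱ = gⁱʲ ∂ⱼ φ` of a function. -/
def gradient (G : EuclideanSpace ℝ (Fin n) → Matrix (Fin n) (Fin n) ℝ)
    (φ : EuclideanSpace ℝ (Fin n) → ℝ) (y : EuclideanSpace ℝ (Fin n)) (i : Fin n) : ℝ :=
  ∑ j, (G y)⁻¹ i j * pderiv j φ y

/-- The Lie derivative `(ℒ_X h)ᵢⱼ = Xᵏ ∂ₖ hᵢⱼ + (∂ᵢ Xᵏ) hₖⱼ + (∂ⱼ Xᵏ) hᵢₖ` of a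
`(0,2)`-tensor. -/
def lieDeriv (X : EuclideanSpace ℝ (Fin n) → Fin n → ℝ)
    (h : EuclideanSpace ℝ (Fin n) → Matrix (Fin n) (Fin n) ℝ)
    (y : EuclideanSpace ℝ (Fin n)) : Matrix (Fin n) (Fin n) ℝ :=
  Matrix.of fun i j => ∑ k, (X y k * pderiv k (fun z => h z i j) y
    + pderiv i (fun z => X z k) y * h y k j + pderiv j (fun z => X z k) y * h y i k)

/-- The covariant derivative `(D_{∂ᵢ} W)ᵏ = ∂ᵢ Wᵏ + Γᵏᵢₗ Wˡ` of a vector field. -/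
def covVec (G : EuclideanSpace ℝ (Fin n) → Matrix (Fin n) (Fin n) ℝ)
    (W : EuclideanSpace ℝ (Fin n) → Fin n → ℝ)
    (y : EuclideanSpace ℝ (Fin n)) (i k : Fin n) : ℝ :=
  pderiv i (fun z => W z k) y + ∑ l, christoffel G y k i l * W y l

/-- The components `(D_X W)ᵏ = Xⁱ (D_{∂ᵢ} W)ᵏ`. -/
def covVecAlong (G : EuclideanSpace ℝ (Fin n) → Matrix (Fin n) (Fin n) ℝ)
    (X W : EuclideanSpace ℝ (Fin n) → Fin n → ℝ)
    (y : EuclideanSpace ℝ (Fin n)) (k : Fin n) : ℝ :=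
  ∑ i, X y i * covVec G W y i k

/-- The second covariant derivative `(D²W)(∂ₐ, ∂ᵢ)ᵏ` of a vector field, that is, the covariant
derivative in the direction `∂ₐ` of the `(1,1)`-tensor `DW`. -/
def covVec₂ (G : EuclideanSpace ℝ (Fin n) → Matrix (Fin n) (Fin n) ℝ)
    (W : EuclideanSpace ℝ (Fin n) → Fin n → ℝ)
    (y : EuclideanSpace ℝ (Fin n)) (a i k : Fin n) : ℝ :=
  pderiv a (fun z => covVec G W z i k) y
    + ∑ l, (christoffel G y k a l * covVec G W y i l - christoffel G y l a i * covVec G W y l k)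

/-- The connection Laplacian `(ΔW)ᵏ = gᵃⁱ (D²W)(∂ₐ, ∂ᵢ)ᵏ` of a vector field. -/
def laplacianVec (G : EuclideanSpace ℝ (Fin n) → Matrix (Fin n) (Fin n) ℝ)
    (W : EuclideanSpace ℝ (Fin n) → Fin n → ℝ)
    (y : EuclideanSpace ℝ (Fin n)) (k : Fin n) : ℝ :=
  ∑ a, ∑ i, (G y)⁻¹ a i * covVec₂ G W y a i k

/-- The covariant derivative `(D_{∂ₐ} h)ᵢⱼ = ∂ₐ hᵢⱼ - Γˡₐᵢ hₗⱼ - Γˡₐⱼ hᵢₗ` of a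
`(0,2)`-tensor. -/
def covTensor (G h : EuclideanSpace ℝ (Fin n) → Matrix (Fin n) (Fin n) ℝ)
    (y : EuclideanSpace ℝ (Fin n)) (a i j : Fin n) : ℝ :=
  pderiv a (fun z => h z i j) y
    - ∑ l, (christoffel G y l a i * h y l j + christoffel G y l a j * h y i l)

/-- The second covariant derivative `(D²h)(∂_b, ∂ₐ)ᵢⱼ` of a `(0,2)`-tensor, that is, the covariant
derivative in the direction `∂_b` of the `(0,3)`-tensor `Dh`. -/
def covTensor₂ (G h : EuclideanSpace ℝ (Fin n) → Matrix (Fin n) (Fin n) ℝ)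
    (y : EuclideanSpace ℝ (Fin n)) (b a i j : Fin n) : ℝ :=
  pderiv b (fun z => covTensor G h z a i j) y
    - ∑ l, (christoffel G y l b a * covTensor G h y l i j
      + christoffel G y l b i * covTensor G h y a l j
      + christoffel G y l b j * covTensor G h y a i l)

/-- The connection Laplacian `(Δh)ᵢⱼ = gᵇᵃ (D²h)(∂_b, ∂ₐ)ᵢⱼ` of a `(0,2)`-tensor. -/
def laplacianTensor (G h : EuclideanSpace ℝ (Fin n) → Matrix (Fin n) (Fin n) ℝ)
    (y : EuclideanSpace ℝ (Fin n)) (i j : Fin n) : ℝ :=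
  ∑ b, ∑ a, (G y)⁻¹ b a * covTensor₂ G h y b a i j

/-- The Lichnerowicz Laplacian of a `(0,2)`-tensor,
`(Δ_L h)ᵢₖ = (Δh)ᵢₖ + 2 gʲᵖ gˡᵠ R(∂ᵢ, ∂ⱼ, ∂ₖ, ∂ₗ) hₚᵩ - h(Ric(∂ᵢ), ∂ₖ) - h(∂ᵢ, Ric(∂ₖ))`. -/
def lichnerowicz (G h : EuclideanSpace ℝ (Fin n) → Matrix (Fin n) (Fin n) ℝ)
    (y : EuclideanSpace ℝ (Fin n)) (i k : Fin n) : ℝ :=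
  laplacianTensor G h y i k
    + 2 * ∑ j, ∑ l, ∑ p, ∑ q, (G y)⁻¹ j p * (G y)⁻¹ l q * riemann G y i j k l * h y p q
    - ∑ p, ricciEndo G y p i * h y p k - ∑ p, ricciEndo G y p k * h y i p

end Coordinates

/-! ### Geometric objects on a manifold and their components in a chart

`M` is a smooth `n`-manifold and `e : M ⇀ ℝⁿ` is a chart with coordinate vector fields `∂ᵢ`. -/

section Manifold

variable {n : ℕ} {M : Type*} [TopologicalSpace M] [ChartedSpace (EuclideanSpace ℝ (Fin n)) M]

/-- The coordinate vector `∂ᵢ` of the chart `e` at the point with coordinates `y`. -/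
def coordVec (e : OpenPartialHomeomorph M (EuclideanSpace ℝ (Fin n)))
    (y : EuclideanSpace ℝ (Fin n)) (i : Fin n) : TangentSpace (𝓡 n) (e.symm y) :=
  mfderiv (𝓡 n) (𝓡 n) e.symm y (EuclideanSpace.single i (1 : ℝ) : EuclideanSpace ℝ (Fin n))

/-- The components `g(∂ᵢ, ∂ⱼ)` of a Riemannian metric in the chart `e`. -/
def metricIn [IsManifold (𝓡 n) ∞ M]
    (g : Bundle.ContMDiffRiemannianMetric (𝓡 n) ∞ (EuclideanSpace ℝ (Fin n))
      (fun x : M => TangentSpace (𝓡 n) x))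
    (e : OpenPartialHomeomorph M (EuclideanSpace ℝ (Fin n)))
    (y : EuclideanSpace ℝ (Fin n)) : Matrix (Fin n) (Fin n) ℝ :=
  Matrix.of fun i j => g.inner (e.symm y) (coordVec e y i) (coordVec e y j)

/-- The components `dyᵏ(W)` of a vector field in the chart `e`. -/
def vecIn (W : ∀ x : M, TangentSpace (𝓡 n) x)
    (e : OpenPartialHomeomorph M (EuclideanSpace ℝ (Fin n)))
    (y : EuclideanSpace ℝ (Fin n)) (k : Fin n) : ℝ :=
  let w : EuclideanSpace ℝ (Fin n) := mfderiv (𝓡 n) (𝓡 n) e (e.symm y) (W (e.symm y))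
  w k

/-- The components in the chart `e` of the gradient `∇f` of a function on `M`. -/
def gradIn [IsManifold (𝓡 n) ∞ M]
    (g : Bundle.ContMDiffRiemannianMetric (𝓡 n) ∞ (EuclideanSpace ℝ (Fin n))
      (fun x : M => TangentSpace (𝓡 n) x)) (f : M → ℝ)
    (e : OpenPartialHomeomorph M (EuclideanSpace ℝ (Fin n))) :
    EuclideanSpace ℝ (Fin n) → Fin n → ℝ :=
  gradient (metricIn g e) (fun z => f (e.symm z))

/-- `(M, g, f)` is an expanding gradient soliton: `f` is smooth and `2 Ric + g = ℒ_{∇f} g`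
on `M`, that is, in every smooth chart. -/
def IsExpandingGradientSoliton [IsManifold (𝓡 n) ∞ M]
    (g : Bundle.ContMDiffRiemannianMetric (𝓡 n) ∞ (EuclideanSpace ℝ (Fin n))
      (fun x : M => TangentSpace (𝓡 n) x)) (f : M → ℝ) : Prop :=
  ContMDiff (𝓡 n) 𝓘(ℝ, ℝ) ∞ f ∧
  ∀ e ∈ IsManifold.maximalAtlas (𝓡 n) ∞ M, ∀ y ∈ e.target, ∀ i j : Fin n,
    2 * ricci (metricIn g e) y i j + metricIn g e y i j
      = lieDeriv (gradIn g f e) (metricIn g e) y i j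

end Manifold

end RicciSoliton

end

noncomputable section

namespace RicciSoliton

/-! Write `Ric` also for the Ricci endomorphism. For every vector field `W`, commuting covariant
derivatives gives `Δ_L (ℒ_W g) = ℒ_{ΔW + Ric W} g - 2 ℒ_W Ric` (`lich_lieInner`). On the soliton `2
Ric = ℒ_X g - g`, so `h = ℒ_W g` satisfies `Δ_L h + ℒ_X h - h = ℒ_{ΔW + Ric W} g + [ℒ_X, ℒ_W] g =
ℒ_V g` with `V = ΔW + Ric W + [X, W]`. Since `X` is a gradient, `D_W X = Ric W + W / 2`
(`two_smul_nab_grad`); hence `V = ΔW + D_X W - W / 2 = 0`. In `lich_lieInner_add_lie` the commutator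
`[ℒ_X, ℒ_W]` is not isolated: second derivatives of `X` and `W` are compared directly, and the
curvature terms cancel by pair symmetry.

The commutation formula rests on the Ricci identities for third derivatives (`nab₃_comm_left`,
`nab₃_comm_right`), the contracted second Bianchi identity (`tr_inner_dcurv`), and the cancellation
of the terms `R * DW` against the zeroth-order curvature term of `Δ_L` (`tr_inner_nab₃`,
`tr_curv_lieInner`).

The claim is local, so one chart suffices. There the calculus is done without indices, over the
algebra of smooth functions; evaluation at points then turns each invariant operator into its
coordinate formula. -/

/-- An algebraic model of the Levi-Civita connection of a framed Riemannian manifold: `A` is the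
algebra of functions, `V` the module of vector fields. -/
structure LeviCivita (A V ι : Type*) [CommRing A] [Algebra ℝ A] [AddCommGroup V] [Module A V]
    [Fintype ι] where
  /-- the action of vector fields on functions -/
  act : V →ₗ[A] Derivation ℝ A A
  /-- the covariant derivative -/
  nab : V →ₗ[A] V →+ V
  nab_smul : ∀ X a Y, nab X (a • Y) = act X a • Y + a • nab X Y
  /-- the metric -/
  inner : V →ₗ[A] V →ₗ[A] A
  inner_symm : ∀ X Y, inner X Y = inner Y X
  act_inner : ∀ X Y Z, act X (inner Y Z) = inner (nab X Y) Z + inner Y (nab X Z)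
  -- The bracket is not separate data: torsion-freeness is encoded by letting `D_X Y - D_Y X` act as
  -- the commutator.
  act_act : ∀ X Y a, act X (act Y a) - act Y (act X a) = act (nab X Y - nab Y X) a
  act_faithful : ∀ X, (∀ a, act X a = 0) → X = 0
  /-- a global frame -/
  frame : ι → V
  /-- the inverse of the Gram matrix of the frame -/
  cometric : ι → ι → A
  cometric_symm : ∀ i j, cometric i j = cometric j i
  -- This carries both the spanning of the frame and the nondegeneracy of the metric; positivity is
  -- never needed.
  reconstruct : ∀ v, ∑ i, ∑ j, (cometric i j * inner v (frame j)) • frame i = v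

namespace LeviCivita

variable {A V ι : Type*} [CommRing A] [Algebra ℝ A] [AddCommGroup V] [Module A V] [Fintype ι]
  (C : LeviCivita A V ι)

/-! ### Curvature: Ricci identities, Bianchi identities and symmetries. -/

section Curvature

/-- The second covariant derivative of a vector field. -/
def hess (W : V) : V →ₗ[A] V →ₗ[A] V :=
  LinearMap.mk₂ A (fun X Y => C.nab X (C.nab Y W) - C.nab (C.nab X Y) W)
    (fun X X' Y => by simp; abel)
    (fun a X Y => by simp [smul_sub])
    (fun X Y Y' => by simp; abel)
    (fun a X Y => by simp [C.nab_smul, smul_sub])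

lemma hess_apply (W X Y : V) :
    C.hess W X Y = C.nab X (C.nab Y W) - C.nab (C.nab X Y) W := rfl

/-- The curvature `R(X, Y) Z`. -/
def curvOp (X Y : V) : V →ₗ[A] V where
  toFun Z := C.nab X (C.nab Y Z) - C.nab Y (C.nab X Z) - C.nab (C.nab X Y - C.nab Y X) Z
  map_add' Z Z' := by simp; abel
  map_smul' a Z := by
    have h := C.act_act X Y a
    simp only [C.nab_smul, map_add, RingHom.id_apply, smul_sub] at h ⊢
    rw [← h]
    simp only [sub_smul]
    abel

/-- The curvature tensor `R(X, Y) Z`, linear in each argument. -/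
def curv : V →ₗ[A] V →ₗ[A] V →ₗ[A] V :=
  LinearMap.mk₂ A C.curvOp
    (fun X X' Y => by ext Z; simp [curvOp]; abel)
    (fun a X Y => by ext Z; simp [curvOp, C.nab_smul, smul_sub]; abel)
    (fun X Y Y' => by ext Z; simp [curvOp]; abel)
    (fun a X Y => by ext Z; simp [curvOp, C.nab_smul, smul_sub]; abel)

lemma curv_apply (X Y Z : V) : C.curv X Y Z =
    C.nab X (C.nab Y Z) - C.nab Y (C.nab X Z) - C.nab (C.nab X Y - C.nab Y X) Z := rfl

lemma hess_sub_hess (W X Y : V) : C.hess W X Y - C.hess W Y X = C.curv X Y W := by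
  simp [hess_apply, curv_apply]; abel

lemma curv_antisymm (X Y Z : V) : C.curv X Y Z = -C.curv Y X Z := by
  simp [curv_apply]; abel

/-- The third covariant derivative of a vector field. -/
def nab₃ (X Y Z W : V) : V :=
  C.nab X (C.hess W Y Z) - C.hess W (C.nab X Y) Z - C.hess W Y (C.nab X Z)

/-- The covariant derivative `(D_X R)(Y, Z) W` of the curvature tensor. -/
def dcurv (X Y Z W : V) : V :=
  C.nab X (C.curv Y Z W) - C.curv (C.nab X Y) Z W - C.curv Y (C.nab X Z) W
    - C.curv Y Z (C.nab X W)

/-- Ricci identity for the (1,1)-tensor `DW`: the curvature acts on its value and, with the opposite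
sign, on its argument. -/
lemma nab₃_comm_left (X Y Z W : V) : C.nab₃ X Y Z W = C.nab₃ Y X Z W
    + C.curv X Y (C.nab Z W) - C.nab (C.curv X Y Z) W := by
  simp [nab₃, hess_apply, curv_apply]; abel

/-- The covariant derivative along `X` of the Ricci identity `hess_sub_hess` for `W`. -/
lemma nab₃_comm_right (X Y Z W : V) : C.nab₃ X Y Z W = C.nab₃ X Z Y W
    + C.dcurv X Y Z W + C.curv Y Z (C.nab X W) := by
  simp [nab₃, dcurv, hess_apply, curv_apply]; abel

/-- The Jacobi identity for the bracket `[X, Y] = D_X Y - D_Y X`. -/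
lemma jacobi (X Y Z : V) :
    (C.nab X (C.nab Y Z - C.nab Z Y) - C.nab (C.nab Y Z - C.nab Z Y) X)
    + (C.nab Y (C.nab Z X - C.nab X Z) - C.nab (C.nab Z X - C.nab X Z) Y)
    + (C.nab Z (C.nab X Y - C.nab Y X) - C.nab (C.nab X Y - C.nab Y X) Z) = 0 := by
  apply C.act_faithful
  intro a
  rw [map_add, map_add, Derivation.add_apply, Derivation.add_apply]
  simp only [← C.act_act]
  simp only [map_sub]
  abel

lemma bianchi_first (X Y Z : V) : C.curv X Y Z + C.curv Y Z X + C.curv Z X Y = 0 := by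
  rw [← C.jacobi X Y Z]
  simp [curv_apply]
  abel

lemma bianchi_second (X Y Z W : V) :
    C.dcurv X Y Z W + C.dcurv Y Z X W + C.dcurv Z X Y W = 0 := by
  -- The terms with three derivatives of `W` cancel cyclically; up to sign, what is left is the
  -- derivative of `W` along the Jacobi sum.
  have h := congrArg (fun v => C.nab v W) (C.jacobi X Y Z)
  simp [dcurv, curv_apply] at h ⊢
  rw [← neg_eq_zero, ← h]
  abel

/-- By metric compatibility the commutator of derivatives acts on the function `⟨Z, U⟩` through
curvature alone. -/
lemma inner_curv_skew (X Y Z U : V) :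
    C.inner (C.curv X Y Z) U = -C.inner (C.curv X Y U) Z := by
  have h := C.act_act X Y (C.inner Z U)
  simp only [C.act_inner, map_add] at h
  rw [C.inner_symm _ Z]
  simp only [curv_apply, map_sub, LinearMap.sub_apply] at h ⊢
  simp only [AddMonoidHom.sub_apply, map_sub, LinearMap.sub_apply] at h ⊢
  linear_combination h

lemma two_cancel {a b : A} (h : 2 * a = 2 * b) : a = b := by
  have h2 : algebraMap ℝ A (1 / 2) * 2 = 1 := by
    rw [← map_ofNat (algebraMap ℝ A) 2, ← map_mul]; norm_num
  linear_combination algebraMap ℝ A (1 / 2) * h - (a - b) * h2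

lemma inner_curv_pair (X Y Z U : V) :
    C.inner (C.curv X Y Z) U = C.inner (C.curv Z U X) Y := by
  have b (P Q S T : V) : C.inner (C.curv P Q S) T + C.inner (C.curv Q S P) T
      + C.inner (C.curv S P Q) T = 0 := by
    rw [← LinearMap.add_apply, ← LinearMap.add_apply, ← map_add, ← map_add, C.bianchi_first]
    simp
  have a (P Q S T : V) : C.inner (C.curv P Q S) T = -C.inner (C.curv Q P S) T := by
    rw [C.curv_antisymm]; simp
  have s := C.inner_curv_skew
  apply two_cancel
  -- The octahedron argument: four first Bianchi identities, combined by the two skew-symmetries,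
  -- give twice the claim.
  linear_combination b X Y Z U + b Y Z U X - b Z U X Y - b U X Y Z - s Y Z U X - s Z U Y X
    - a U Y Z X + s U X Z Y + a X Z U Y - s Z X U Y + s X Y U Z + s Y U X Z

lemma inner_dcurv_pair (X Y Z U T : V) :
    C.inner (C.dcurv T X Y Z) U = C.inner (C.dcurv T Z U X) Y := by
  have h := congrArg (C.act T) (C.inner_curv_pair X Y Z U)
  simp only [C.act_inner] at h
  simp only [dcurv, map_sub, LinearMap.sub_apply]
  linear_combination h - C.inner_curv_pair (C.nab T X) Y Z U - C.inner_curv_pair X (C.nab T Y) Z U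
    - C.inner_curv_pair X Y (C.nab T Z) U - C.inner_curv_pair X Y Z (C.nab T U)

lemma dcurv_antisymm (T X Y Z : V) : C.dcurv T X Y Z = -C.dcurv T Y X Z := by
  rw [dcurv, dcurv, C.curv_antisymm X Y, C.curv_antisymm (C.nab T X) Y,
    C.curv_antisymm X (C.nab T Y), C.curv_antisymm X Y, map_neg]
  abel

end Curvature

/-! ### Metric traces and their compatibility with the connection. -/

section Trace

lemma sum_comm_pairs {α β N : Type*} [Fintype α] [Fintype β] [AddCommMonoid N]
    (F : α → α → β → β → N) :
    ∑ i, ∑ j, ∑ k, ∑ l, F i j k l = ∑ k, ∑ l, ∑ i, ∑ j, F i j k l := by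
  simpa only [Fintype.sum_prod_type] using Finset.sum_comm (s := Finset.univ) (t := Finset.univ)
    (f := fun (p : α × α) (q : β × β) => F p.1 p.2 q.1 q.2)

variable {N : Type*} [AddCommGroup N] [Module A N]

/-- The trace of a bilinear map with respect to the metric. -/
def tr (T : V → V → N) : N :=
  ∑ i, ∑ j, C.cometric i j • T (C.frame i) (C.frame j)

lemma tr_add (S T : V → V → N) : C.tr (fun a b => S a b + T a b) = C.tr S + C.tr T := by
  simp [tr, Finset.sum_add_distrib]

lemma tr_neg (T : V → V → N) : C.tr (fun a b => -T a b) = -C.tr T := by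
  simp [tr]

lemma tr_sub (S T : V → V → N) : C.tr (fun a b => S a b - T a b) = C.tr S - C.tr T := by
  simp [tr, smul_sub]

lemma tr_smul (c : A) (T : V → V → N) : C.tr (fun a b => c • T a b) = c • C.tr T := by
  simp only [tr, Finset.smul_sum, smul_comm c]

lemma tr_swap (T : V → V → N) : C.tr (fun a b => T b a) = C.tr T := by
  unfold tr
  rw [Finset.sum_comm]
  simp only [C.cometric_symm]

lemma map_tr {N' : Type*} [AddCommGroup N'] [Module A N'] (L : N →ₗ[A] N') (T : V → V → N) :
    L (C.tr T) = C.tr (fun a b => L (T a b)) := by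
  simp [tr]

lemma tr_comm (T : V → V → V → V → N) :
    C.tr (fun a b => C.tr fun c d => T a b c d) = C.tr (fun c d => C.tr fun a b => T a b c d) := by
  simp only [tr, Finset.smul_sum]
  rw [sum_comm_pairs]
  simp only [smul_comm (C.cometric _ _) (C.cometric _ _)]

lemma tr_inner_smul (v : V) (L : V →ₗ[A] N) :
    C.tr (fun a b => C.inner v b • L a) = L v := by
  conv_rhs => rw [← C.reconstruct v]
  simp [tr, smul_smul]

/-- The cometric is parallel. -/
lemma sum_act_cometric (X : V) (T : V →ₗ[A] V →ₗ[A] N) :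
    ∑ i, ∑ j, C.act X (C.cometric i j) • T (C.frame i) (C.frame j)
      + C.tr (fun a b => T (C.nab X a) b + T a (C.nab X b)) = 0 := by
  -- Differentiate the reconstruction of `v` along `X` and subtract the reconstruction of `D_X v`.
  have key (v : V) : ∑ i, ∑ j, ((C.act X (C.cometric i j) * C.inner v (C.frame j)) • C.frame i
      + ((C.cometric i j * C.inner v (C.nab X (C.frame j))) • C.frame i
      + (C.cometric i j * C.inner v (C.frame j)) • C.nab X (C.frame i))) = 0 := by
    have h := congrArg (C.nab X) (C.reconstruct v)
    have h' := C.reconstruct (C.nab X v)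
    simp only [map_sum, C.nab_smul, Derivation.leibniz, C.act_inner] at h
    replace h := sub_eq_zero.2 (h.trans h'.symm)
    rw [← Finset.sum_sub_distrib] at h
    rw [← h]
    refine Finset.sum_congr rfl fun i _ => ?_
    rw [← Finset.sum_sub_distrib]
    refine Finset.sum_congr rfl fun j _ => ?_
    simp only [smul_eq_mul]
    module
  have expand (p w : V) : T p w
      = ∑ k, ∑ l, (C.cometric k l * C.inner w (C.frame l)) • T p (C.frame k) := by
    conv_lhs => rw [← C.reconstruct w]
    simp
  -- Take `v = e_l` in `key`, insert it in the first slot of `T(·, e_k)` and contract with `gᵏˡ`.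
  have h : ∑ k, ∑ l, C.cometric k l • T (∑ i, ∑ j,
      ((C.act X (C.cometric i j) * C.inner (C.frame l) (C.frame j)) • C.frame i
      + ((C.cometric i j * C.inner (C.frame l) (C.nab X (C.frame j))) • C.frame i
      + (C.cometric i j * C.inner (C.frame l) (C.frame j)) • C.nab X (C.frame i))))
      (C.frame k) = 0 := by
    simp only [key]; simp
  rw [← h]
  simp only [tr, ← Finset.sum_add_distrib]
  simp only [map_sum, LinearMap.sum_apply, Finset.smul_sum]
  rw [sum_comm_pairs]
  refine Finset.sum_congr rfl fun i _ => Finset.sum_congr rfl fun j _ => ?_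
  rw [expand (C.frame i) (C.frame j), expand (C.nab X (C.frame i)),
    expand (C.frame i) (C.nab X (C.frame j))]
  simp only [Finset.smul_sum, ← Finset.sum_add_distrib]
  refine Finset.sum_congr rfl fun k _ => Finset.sum_congr rfl fun l _ => ?_
  simp only [map_add, map_smul, LinearMap.add_apply, LinearMap.smul_apply, smul_add, smul_smul,
    C.inner_symm (C.frame l)]
  module

/-- Because the cometric is parallel, tracing commutes with covariant differentiation; this lets `D`
pass through `Δ` and `Ric`. -/
lemma nab_tr (X : V) (T : V →ₗ[A] V →ₗ[A] V) :
    C.nab X (C.tr fun a b => T a b)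
      = C.tr fun a b => C.nab X (T a b) - T (C.nab X a) b - T a (C.nab X b) := by
  have h := C.sum_act_cometric X T
  rw [tr_add] at h
  rw [tr_sub, tr_sub]
  simp only [tr, map_sum, C.nab_smul, Finset.sum_add_distrib] at h ⊢
  rw [eq_neg_of_add_eq_zero_left h]
  abel

end Trace

end LeviCivita

namespace LeviCivita

variable {A V ι : Type*} [CommRing A] [Algebra ℝ A] [AddCommGroup V] [Module A V] [Fintype ι]
  (C : LeviCivita A V ι)

/-! ### The Lichnerowicz Laplacian of a Lie derivative, and the soliton equation. -/

section Operators

/-- The endomorphism `Y ↦ D_Y W`. -/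
def endo (W : V) : V →ₗ[A] V where
  toFun Y := C.nab Y W
  map_add' _ _ := by simp
  map_smul' _ _ := by simp

lemma endo_apply (W Y : V) : C.endo W Y = C.nab Y W := rfl

/-- The Ricci endomorphism. -/
def ric : V →ₗ[A] V where
  toFun Y := C.tr fun a b => C.curv Y a b
  map_add' _ _ := by simp [tr_add]
  map_smul' _ _ := by simp [tr_smul]

lemma ric_apply (Y : V) : C.ric Y = C.tr fun a b => C.curv Y a b := rfl

/-- The connection Laplacian of a vector field. -/
def lap (W : V) : V := C.tr fun a b => C.hess W a b

/-- The Lie derivative of the metric. -/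
def lieInner (W : V) : V →ₗ[A] V →ₗ[A] A :=
  LinearMap.mk₂ A (fun Y Z => C.inner (C.nab Y W) Z + C.inner Y (C.nab Z W))
    (fun _ _ _ => by simp; abel) (fun _ _ _ => by simp [mul_add])
    (fun _ _ _ => by simp; abel) (fun _ _ _ => by simp [mul_add])

lemma lieInner_apply (W Y Z : V) :
    C.lieInner W Y Z = C.inner (C.nab Y W) Z + C.inner Y (C.nab Z W) := rfl

/-- The covariant derivative of a bilinear form. -/
def cov (T : V →ₗ[A] V →ₗ[A] A) : V →ₗ[A] V →ₗ[A] V →ₗ[A] A :=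
  LinearMap.mk₂ A
    (fun X Y =>
      { toFun := fun Z => C.act X (T Y Z) - T (C.nab X Y) Z - T Y (C.nab X Z)
        map_add' := fun _ _ => by simp; abel
        map_smul' := fun _ _ => by simp [C.nab_smul]; ring } : V → V → V →ₗ[A] A)
    (fun _ _ _ => by ext; simp; abel) (fun _ _ _ => by ext; simp [mul_sub])
    (fun _ _ _ => by ext; simp; abel) (fun _ _ _ => by ext; simp [C.nab_smul]; ring)

lemma cov_apply (T : V →ₗ[A] V →ₗ[A] A) (X Y Z : V) :
    C.cov T X Y Z = C.act X (T Y Z) - T (C.nab X Y) Z - T Y (C.nab X Z) := rfl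

/-- The second covariant derivative of a bilinear form. -/
def cov₂ (T : V →ₗ[A] V →ₗ[A] A) (B X Y Z : V) : A :=
  C.act B (C.cov T X Y Z) - C.cov T (C.nab B X) Y Z - C.cov T X (C.nab B Y) Z
    - C.cov T X Y (C.nab B Z)

/-- The Lichnerowicz Laplacian of a bilinear form. -/
def lich (T : V →ₗ[A] V →ₗ[A] A) (Y Z : V) : A :=
  C.tr (fun b a => C.cov₂ T b a Y Z)
    + 2 * C.tr (fun j p => C.tr fun l q => C.inner (C.curv Y j l) Z * T p q)
    - T (C.ric Y) Z - T Y (C.ric Z)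

/-- The Lie derivative of a bilinear form. -/
def lie (X : V) (T : V →ₗ[A] V →ₗ[A] A) (Y Z : V) : A :=
  C.cov T X Y Z + T (C.nab Y X) Z + T Y (C.nab Z X)

lemma lie_inner (W Y Z : V) : C.lie W C.inner Y Z = C.lieInner W Y Z := by
  simp [lie, cov_apply, lieInner_apply, C.act_inner]

lemma cov_lieInner (W X Y Z : V) : C.cov (C.lieInner W) X Y Z
    = C.inner (C.hess W X Y) Z + C.inner Y (C.hess W X Z) := by
  simp [cov_apply, lieInner_apply, hess_apply, C.act_inner]; ring

lemma cov₂_lieInner (W B X Y Z : V) : C.cov₂ (C.lieInner W) B X Y Z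
    = C.inner (C.nab₃ B X Y W) Z + C.inner Y (C.nab₃ B X Z W) := by
  simp [cov₂, cov_lieInner, nab₃, C.act_inner]; ring

lemma nab_lap (W Y : V) : C.nab Y (C.lap W) = C.tr fun a b => C.nab₃ Y a b W :=
  C.nab_tr Y (C.hess W)

/-- The trace of the derivative of the curvature is the derivative of the Ricci endomorphism. -/
lemma tr_dcurv (W Z : V) : C.tr (fun a b => C.dcurv W Z a b)
    = C.nab W (C.ric Z) - C.ric (C.nab W Z) := by
  rw [ric_apply, ric_apply, C.nab_tr W (C.curv Z), ← tr_sub]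
  congr! 3
  simp only [dcurv]; abel

/-- The contracted second Bianchi identity. -/
lemma tr_inner_dcurv (W Y Z : V) : C.tr (fun b a => C.inner (C.dcurv b a Y W) Z)
    = C.inner (C.nab Z (C.ric W) - C.ric (C.nab Z W)) Y
      - C.inner (C.nab W (C.ric Z) - C.ric (C.nab W Z)) Y := by
  rw [← tr_dcurv, ← tr_dcurv, C.inner_symm _ Y, C.inner_symm _ Y, map_tr, map_tr, ← tr_sub]
  congr! 3 with b a
  -- Pair symmetry turns the integrand into `⟨(D_b R)(W, Z) a, Y⟩`; the second Bianchi identity then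
  -- moves the derivative onto `W` and `Z`.
  rw [C.inner_dcurv_pair a Y W Z b, C.inner_symm Y, C.inner_symm Y, ← LinearMap.sub_apply,
    ← map_sub]
  congr 2
  rw [eq_sub_iff_add_eq, ← sub_eq_zero, ← C.bianchi_second b W Z a, C.dcurv_antisymm Z b W a]
  abel

/-- Move `Y` from the innermost to the outermost slot of `D³W`. The two exchanges produce the
divergence of `R`, two curvature terms equal under the trace, and a derivative along `Ric Y`. -/
lemma tr_inner_nab₃ (W Y Z : V) : C.tr (fun b a => C.inner (C.nab₃ b a Y W) Z)
    = C.inner (C.nab Y (C.lap W)) Z + C.tr (fun b a => C.inner (C.dcurv b a Y W) Z)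
      + 2 * C.tr (fun b a => C.inner (C.curv a Y (C.nab b W)) Z)
      + C.inner (C.nab (C.ric Y) W) Z := by
  have h (b a : V) : C.inner (C.nab₃ b a Y W) Z = C.inner Z (C.nab₃ Y b a W)
      + C.inner (C.dcurv b a Y W) Z + C.inner (C.curv a Y (C.nab b W)) Z
      + C.inner (C.curv b Y (C.nab a W)) Z + C.inner Z (C.endo W (C.curv Y b a)) := by
    rw [C.nab₃_comm_right, C.nab₃_comm_left, C.curv_antisymm Y b a, C.inner_symm Z,
      C.inner_symm Z, endo_apply]
    simp only [map_add, map_sub, map_neg, LinearMap.add_apply, LinearMap.sub_apply,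
      LinearMap.neg_apply, AddMonoidHom.neg_apply]
    ring
  simp only [h, tr_add]
  rw [← map_tr, ← map_tr, ← map_tr, ← nab_lap, ← ric_apply, endo_apply, C.inner_symm Z,
    C.inner_symm Z, C.tr_swap (fun b a => C.inner (C.curv a Y (C.nab b W)) Z)]
  ring

/-- Each half of `ℒ_W g` raises one index of `R`. The result is arranged to cancel the factor-two
curvature terms of `tr_inner_nab₃` for `(Y, Z)` and `(Z, Y)`. -/
lemma tr_curv_lieInner (W Y Z : V) :
    C.tr (fun j p => C.tr fun l q => C.inner (C.curv Y j l) Z * C.lieInner W p q)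
    = - C.tr (fun b a => C.inner (C.curv a Y (C.nab b W)) Z)
      - C.tr (fun b a => C.inner (C.curv a Z (C.nab b W)) Y) := by
  have h₁ (j p : V) : C.tr (fun l q => C.inner (C.curv Y j l) Z * C.inner (C.nab p W) q)
      = - C.inner (C.curv j Y (C.nab p W)) Z := by
    have h := C.tr_inner_smul (C.nab p W) (C.inner.flip Z ∘ₗ C.curv Y j)
    simp only [LinearMap.comp_apply, LinearMap.flip_apply, smul_eq_mul] at h
    rw [C.curv_antisymm j Y, map_neg, LinearMap.neg_apply, neg_neg, ← h]
    simp only [mul_comm (C.inner (C.curv Y j _) Z)]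
  have h₂ (l q : V) : C.tr (fun j p => C.inner (C.curv Y j l) Z * C.inner p (C.nab q W))
      = - C.inner (C.curv l Z (C.nab q W)) Y := by
    have h := C.tr_inner_smul (C.nab q W) (C.inner.flip Z ∘ₗ (C.curv Y).flip l)
    simp only [LinearMap.comp_apply, LinearMap.flip_apply, smul_eq_mul] at h
    simp only [mul_comm (C.inner (C.curv Y _ l) Z), C.inner_symm _ (C.nab q W), h]
    rw [C.inner_curv_pair, C.inner_curv_skew]
  simp only [lieInner_apply, mul_add, tr_add]
  rw [C.tr_comm (fun j p l q => C.inner (C.curv Y j l) Z * C.inner p (C.nab q W))]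
  simp only [h₁, h₂, tr_neg]
  rw [C.tr_swap (fun b a => C.inner (C.curv a Y (C.nab b W)) Z),
    C.tr_swap (fun b a => C.inner (C.curv a Z (C.nab b W)) Y)]
  ring

/-- The Lichnerowicz Laplacian of the Lie derivative of the metric: it is
`Δ_L (ℒ_W g) = ℒ_{ΔW + Ric W} g - 2 ℒ_W Ric`, with the terms in `Ric` written out. -/
lemma lich_lieInner (W Y Z : V) : C.lich (C.lieInner W) Y Z
    = C.lieInner (C.lap W) Y Z
      + C.inner (C.nab Z (C.ric W) - C.ric (C.nab Z W)) Y
      + C.inner (C.nab Y (C.ric W) - C.ric (C.nab Y W)) Z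
      - C.inner (C.nab W (C.ric Z) - C.ric (C.nab W Z)) Y
      - C.inner (C.nab W (C.ric Y) - C.ric (C.nab W Y)) Z
      - C.inner (C.ric Y) (C.nab Z W) - C.inner (C.nab Y W) (C.ric Z) := by
  rw [lich, tr_curv_lieInner]
  simp only [cov₂_lieInner, tr_add, C.inner_symm Y]
  -- Besides the terms `R * DW`, the derivatives of `W` along `Ric Y` and `Ric Z` cancel against
  -- those in `ℒ_W g (Ric ·, ·)`.
  rw [tr_inner_nab₃, tr_inner_nab₃, tr_inner_dcurv, tr_inner_dcurv]
  simp only [lieInner_apply, C.inner_symm Y]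
  ring

lemma eq_of_inner_frame {v w : V} (h : ∀ j, C.inner v (C.frame j) = C.inner w (C.frame j)) :
    v = w := by
  rw [← C.reconstruct v, ← C.reconstruct w]
  simp only [h]

lemma linearMap_ext_frame {L L' : V →ₗ[A] V} (h : ∀ i, L (C.frame i) = L' (C.frame i)) :
    L = L' := by
  ext v
  rw [← C.reconstruct v]
  simp only [map_sum, map_smul, h]

/-- The gradient of a function. -/
def grad (f : A) : V := ∑ i, ∑ j, (C.cometric i j * C.act (C.frame j) f) • C.frame i

lemma inner_grad (f : A) (Z : V) : C.inner (C.grad f) Z = C.act Z f := by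
  let L : V →ₗ[A] A :=
    { toFun := fun Z => C.act Z f
      map_add' := fun _ _ => by simp
      map_smul' := fun _ _ => by simp }
  have h : L Z = ∑ i, ∑ j, C.cometric i j * C.inner Z (C.frame j) * L (C.frame i) := by
    conv_lhs => rw [← C.reconstruct Z]
    simp
  change _ = L Z
  rw [h, Finset.sum_comm, C.inner_symm, grad]
  simp only [map_sum, map_smul, smul_eq_mul]
  refine Finset.sum_congr rfl fun i _ => Finset.sum_congr rfl fun j _ => ?_
  rw [C.cometric_symm i j, mul_right_comm]
  rfl

/-- The Hessian of a function is symmetric. -/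
lemma inner_nab_grad_symm (f : A) (Y Z : V) :
    C.inner (C.nab Y (C.grad f)) Z = C.inner (C.nab Z (C.grad f)) Y := by
  have h := C.act_act Y Z f
  have h₁ := C.act_inner Y (C.grad f) Z
  have h₂ := C.act_inner Z (C.grad f) Y
  rw [inner_grad, inner_grad] at h₁ h₂
  rw [map_sub, Derivation.sub_apply] at h
  linear_combination h₂ - h₁ + h

/-- On an expanding gradient soliton `D_Y X = Ric(Y) + Y / 2`. -/
lemma two_smul_nab_grad {f : A}
    (hsol : ∀ i j, 2 * C.inner (C.ric (C.frame i)) (C.frame j) + C.inner (C.frame i) (C.frame j)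
      = C.lieInner (C.grad f) (C.frame i) (C.frame j)) (Y : V) :
    (2 : A) • C.nab Y (C.grad f) = (2 : A) • C.ric Y + Y := by
  -- Both sides are linear in `Y`, so the frame suffices; symmetry of the Hessian makes `ℒ_{∇f} g`
  -- twice the Hessian.
  have h : (2 : A) • C.endo (C.grad f) = (2 : A) • C.ric + LinearMap.id := by
    refine C.linearMap_ext_frame fun i => C.eq_of_inner_frame fun j => ?_
    have h₁ := hsol i j
    have h₂ := C.inner_nab_grad_symm f (C.frame i) (C.frame j)
    rw [lieInner_apply, C.inner_symm (C.frame i) (C.nab _ _)] at h₁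
    simp only [LinearMap.add_apply, LinearMap.smul_apply, map_add, map_smul, smul_eq_mul,
      endo_apply, LinearMap.id_apply]
    linear_combination h₂ - h₁
  exact DFunLike.congr_fun h Y

theorem lich_lieInner_add_lie {W : V} {f : A}
    (hsol : ∀ i j, 2 * C.inner (C.ric (C.frame i)) (C.frame j) + C.inner (C.frame i) (C.frame j)
      = C.lieInner (C.grad f) (C.frame i) (C.frame j))
    (hW : (2 : A) • C.lap W + (2 : A) • C.nab (C.grad f) W = W) (Y Z : V) :
    C.lich (C.lieInner W) Y Z + C.lie (C.grad f) (C.lieInner W) Y Z - C.lieInner W Y Z = 0 := by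
  set X := C.grad f
  have hs := C.two_smul_nab_grad hsol
  have nab_two (P Q : V) : C.nab P ((2 : A) • Q) = (2 : A) • C.nab P Q := by
    simp [two_smul]
  -- As the identity is parallel, `D Ric = D²X`.
  have dric (P Q S : V) : C.inner (C.nab P (C.ric Q) - C.ric (C.nab P Q)) S
      = C.inner (C.hess X P Q) S := by
    have h₁ := congrArg (C.nab P) (hs Q)
    have h₂ := hs (C.nab P Q)
    rw [map_add, nab_two, nab_two] at h₁
    apply two_cancel
    have h : (2 : A) • (C.nab P (C.ric Q) - C.ric (C.nab P Q)) = (2 : A) • C.hess X P Q := by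
      rw [smul_sub, hess_apply, smul_sub, h₁, h₂]
      abel
    simpa using congrArg (fun v => C.inner v S) h
  -- The derivative of the equation for `W` along `P`. The two terms in `D_P W` cancel: one comes
  -- from `W / 2`, the other from `D_P X = Ric P + P / 2`.
  have hlap (P Q : V) : 2 * C.inner (C.nab P (C.lap W)) Q = C.inner (C.nab P W) Q
      - 2 * C.inner (C.hess W P X) Q - 2 * C.inner (C.nab (C.ric P) W) Q
      - C.inner (C.nab P W) Q := by
    have h₁ := congrArg (fun v => C.inner (C.nab P v) Q) hW
    have h₂ := congrArg (fun v => C.inner (C.nab v W) Q) (hs P)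
    simp only [map_add, nab_two, map_smul, LinearMap.add_apply, LinearMap.smul_apply,
      AddMonoidHom.add_apply, AddMonoidHom.smul_apply, smul_eq_mul] at h₁ h₂
    rw [hess_apply, map_sub, LinearMap.sub_apply]
    linear_combination h₁ - h₂
  have hcurv (P Q U S : V) : C.inner (C.hess U P Q) S - C.inner (C.hess U Q P) S
      = C.inner (C.curv P Q U) S := by
    rw [← hess_sub_hess, map_sub, LinearMap.sub_apply]
  have hlie (P Q : V) : 2 * C.inner (C.nab (C.nab P X) W) Q
      = 2 * C.inner (C.nab (C.ric P) W) Q + C.inner (C.nab P W) Q := by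
    have h₂ := congrArg (fun v => C.inner (C.nab v W) Q) (hs P)
    simpa using h₂
  have hlie' (P Q : V) : 2 * C.inner (C.nab P X) (C.nab Q W)
      = 2 * C.inner (C.ric P) (C.nab Q W) + C.inner P (C.nab Q W) := by
    have h₂ := congrArg (fun v => C.inner v (C.nab Q W)) (hs P)
    simpa using h₂
  rw [lich_lieInner]
  simp only [dric, lie, cov_lieInner, lieInner_apply]
  rw [C.inner_symm Y (C.nab Z _), C.inner_symm Y (C.hess _ _ _), C.inner_symm Y (C.nab _ _),
    C.inner_symm Y (C.nab _ _), C.inner_symm (C.nab Y W) (C.nab Z X),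
    C.inner_symm (C.nab Y W) (C.ric Z)]
  apply two_cancel
  rw [mul_zero]
  -- What survives is `⟨R(Z, W) X, Y⟩ + ⟨R(X, Y) W, Z⟩` and its mirror in `Y, Z`; each vanishes by
  -- pair symmetry and skewness.
  linear_combination hlap Y Z + hlap Z Y + hlie Y Z + hlie Z Y + hlie' Y Z + hlie' Z Y
    + 2 * hcurv X Y W Z + 2 * hcurv X Z W Y + 2 * hcurv Z W X Y + 2 * hcurv Y W X Z
    + 2 * C.inner_curv_pair Z W X Y + 2 * C.inner_curv_pair Y W X Z
    + 2 * C.inner_curv_skew X Y W Z + 2 * C.inner_curv_skew X Z W Y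
    + C.inner_symm Y (C.nab Z W) + C.inner_symm Z (C.nab Y W)

end Operators

end LeviCivita

/-! ### Smooth functions on an open set as an algebra with commuting derivations. -/

section SmoothFunctions

variable {n : ℕ}

/-- The extension by zero of a function on an open set. -/
def extendZero (U : Set (EuclideanSpace ℝ (Fin n))) (φ : U → ℝ)
    (z : EuclideanSpace ℝ (Fin n)) : ℝ :=
  open Classical in if h : z ∈ U then φ ⟨z, h⟩ else 0

lemma extendZero_of_mem {U : Set (EuclideanSpace ℝ (Fin n))} (φ : U → ℝ)
    {z : EuclideanSpace ℝ (Fin n)} (h : z ∈ U) : extendZero U φ z = φ ⟨z, h⟩ := dif_pos h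

lemma extendZero_eqOn {U : Set (EuclideanSpace ℝ (Fin n))} {φ : U → ℝ}
    {ψ : EuclideanSpace ℝ (Fin n) → ℝ} (h : ∀ z : U, φ z = ψ z) : Set.EqOn (extendZero U φ) ψ U :=
  fun z hz => by rw [extendZero_of_mem _ hz, h]

/-- The algebra of smooth functions on a subset of `ℝⁿ`. -/
def smoothFun (U : Set (EuclideanSpace ℝ (Fin n))) : Subalgebra ℝ (U → ℝ) where
  carrier := {φ | ContDiffOn ℝ ∞ (extendZero U φ) U}
  mul_mem' {φ ψ} hφ hψ := (ContDiffOn.mul hφ hψ).congr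
    (extendZero_eqOn fun z => by simp [extendZero_of_mem _ z.2])
  add_mem' {φ ψ} hφ hψ := (ContDiffOn.add hφ hψ).congr
    (extendZero_eqOn fun z => by simp [extendZero_of_mem _ z.2])
  algebraMap_mem' c := (contDiffOn_const (c := c)).congr (extendZero_eqOn fun _ => rfl)

/-- The element of `smoothFun U` given by a function smooth on `U`. -/
def toSmooth {U : Set (EuclideanSpace ℝ (Fin n))} (φ : EuclideanSpace ℝ (Fin n) → ℝ)
    (h : ContDiffOn ℝ ∞ φ U) : smoothFun U :=
  ⟨fun z => φ z, h.congr (extendZero_eqOn fun _ => rfl)⟩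

lemma toSmooth_apply {U : Set (EuclideanSpace ℝ (Fin n))} (φ : EuclideanSpace ℝ (Fin n) → ℝ)
    (h : ContDiffOn ℝ ∞ φ U) (z : U) : (toSmooth φ h).1 z = φ z := rfl

lemma smoothFun_ext {U : Set (EuclideanSpace ℝ (Fin n))} {a b : smoothFun U}
    (h : ∀ z, a.1 z = b.1 z) : a = b := Subtype.ext (funext h)

lemma pderiv_congr {U : Set (EuclideanSpace ℝ (Fin n))} (hU : IsOpen U) (i : Fin n)
    {φ ψ : EuclideanSpace ℝ (Fin n) → ℝ} (h : Set.EqOn φ ψ U) :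
    Set.EqOn (pderiv i φ) (pderiv i ψ) U :=
  fun z hz => by
    rw [pderiv, pderiv, (h.eventuallyEq_of_mem (hU.mem_nhds hz)).fderiv_eq]

lemma contDiffOn_pderiv {U : Set (EuclideanSpace ℝ (Fin n))} (hU : IsOpen U) (i : Fin n)
    {φ : EuclideanSpace ℝ (Fin n) → ℝ} (h : ContDiffOn ℝ ∞ φ U) : ContDiffOn ℝ ∞ (pderiv i φ) U :=
  (h.fderiv_of_isOpen hU (by simp)).clm_apply contDiffOn_const

variable {U : Set (EuclideanSpace ℝ (Fin n))} (hU : IsOpen U)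

/-- The partial derivative `∂ᵢ` on smooth functions. -/
def partialDer (hU : IsOpen U) (i : Fin n) :
    Derivation ℝ (smoothFun U)
      (smoothFun U) :=
  have diff (a : smoothFun U) (z : U) :
      DifferentiableAt ℝ (extendZero U a.1) z :=
    (ContDiffOn.contDiffAt a.2 (hU.mem_nhds z.2)).differentiableAt (by simp)
  Derivation.mk'
    { toFun := fun a => toSmooth (pderiv i (extendZero U a.1)) (contDiffOn_pderiv hU i a.2)
      map_add' := fun a b => smoothFun_ext fun z => by
        have h : Set.EqOn (extendZero U (a + b).1) (extendZero U a.1 + extendZero U b.1) U :=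
          extendZero_eqOn fun z => by simp [extendZero_of_mem _ z.2]
        rw [toSmooth_apply, pderiv_congr hU i h z.2, pderiv, fderiv_add (diff a z) (diff b z)]
        rfl
      map_smul' := fun c a => smoothFun_ext fun z => by
        have h : Set.EqOn (extendZero U (c • a).1) (c • extendZero U a.1) U :=
          extendZero_eqOn fun z => by simp [extendZero_of_mem _ z.2]
        rw [toSmooth_apply, pderiv_congr hU i h z.2, pderiv, fderiv_const_smul (diff a z)]
        rfl }
    fun a b => smoothFun_ext fun z => by
      have h : Set.EqOn (extendZero U (a * b).1) (extendZero U a.1 * extendZero U b.1) U :=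
        extendZero_eqOn fun z => by simp [extendZero_of_mem _ z.2]
      change pderiv i _ _ = _
      rw [pderiv_congr hU i h z.2, pderiv, fderiv_mul (diff a z) (diff b z)]
      simp only [extendZero_of_mem _ z.2]
      rfl

lemma partialDer_apply (i : Fin n) (a : smoothFun U) (z : U) :
    (partialDer hU i a).1 z = pderiv i (extendZero U a.1) z := rfl

lemma partialDer_of_eq (i : Fin n) {a : smoothFun U}
    {φ : EuclideanSpace ℝ (Fin n) → ℝ} (h : ∀ z : U, a.1 z = φ z) (z : U) :
    (partialDer hU i a).1 z = pderiv i φ z := by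
  rw [partialDer_apply, pderiv_congr hU i (extendZero_eqOn h) z.2]

lemma two_le_infty : (2 : WithTop ℕ∞) ≤ ∞ := WithTop.coe_le_coe.2 (le_top : (2 : ℕ∞) ≤ ⊤)

lemma pderiv_pderiv_comm {U : Set (EuclideanSpace ℝ (Fin n))} (hU : IsOpen U) (i j : Fin n)
    {φ : EuclideanSpace ℝ (Fin n) → ℝ} (h : ContDiffOn ℝ ∞ φ U) {z : EuclideanSpace ℝ (Fin n)}
    (hz : z ∈ U) : pderiv i (pderiv j φ) z = pderiv j (pderiv i φ) z := by
  have hφ : ContDiffAt ℝ ∞ φ z := h.contDiffAt (hU.mem_nhds hz)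
  have hd : DifferentiableAt ℝ (fderiv ℝ φ) z :=
    (hφ.fderiv_right (m := 1) (one_add_one_eq_two.trans_le two_le_infty)).differentiableAt (by simp)
  have key (i j : Fin n) : pderiv i (pderiv j φ) z
      = fderiv ℝ (fderiv ℝ φ) z (EuclideanSpace.single i 1) (EuclideanSpace.single j 1) := by
    unfold pderiv
    rw [fderiv_clm_apply hd (differentiableAt_const _)]
    simp
  rw [key, key]
  exact (hφ.isSymmSndFDerivAt (minSmoothness_of_isRCLikeNormedField.trans_le two_le_infty)).eq _ _

lemma partialDer_comm (i j : Fin n) (a : smoothFun U) :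
    partialDer hU i (partialDer hU j a) = partialDer hU j (partialDer hU i a) :=
  smoothFun_ext fun z => by
    rw [partialDer_of_eq hU i (partialDer_apply hU j a),
      partialDer_of_eq hU j (partialDer_apply hU i a),
      pderiv_pderiv_comm hU i j a.2 z.2]

/-- The coordinate functions. -/
def coordFun (U : Set (EuclideanSpace ℝ (Fin n))) (k : Fin n) :
    smoothFun U :=
  toSmooth (fun z => z k) (by fun_prop)

lemma partialDer_coordFun (i k : Fin n) :
    partialDer hU i (coordFun U k) = if i = k then 1 else 0 :=
  smoothFun_ext fun z => by
    rw [partialDer_of_eq hU i (φ := fun z => z k) (fun _ => rfl), pderiv]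
    have h : HasFDerivAt (fun z : EuclideanSpace ℝ (Fin n) => z k)
      (EuclideanSpace.proj (𝕜 := ℝ) k) (z : EuclideanSpace ℝ (Fin n)) :=
      (EuclideanSpace.proj (𝕜 := ℝ) k).hasFDerivAt
    rw [h.fderiv]
    by_cases hik : i = k
    · subst hik; simp
    · simp [hik, Ne.symm hik]

end SmoothFunctions

/-! ### The Levi-Civita connection built from Christoffel symbols. -/

section LeviCivitaOfMatrix

variable {n : ℕ} {A : Type*} [CommRing A] [Algebra ℝ A]

/-- The Christoffel symbols `Γᵏᵢⱼ` of a metric with components `G` and inverse `H`, with respect to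
the derivations `d`. -/
def christoffelSymbol (d : Fin n → Derivation ℝ A A) (G H : Fin n → Fin n → A)
    (k i j : Fin n) : A :=
  (1 / 2 : ℝ) • ∑ l, H k l * (d i (G j l) + d j (G i l) - d l (G i j))

variable {d : Fin n → Derivation ℝ A A} {G H : Fin n → Fin n → A}

lemma christoffelSymbol_symm (hG : ∀ i j, G i j = G j i) (k i j : Fin n) :
    christoffelSymbol d G H k i j = christoffelSymbol d G H k j i := by
  simp only [christoffelSymbol, hG i j, add_comm (d i _)]

lemma sum_mul_christoffelSymbol (hGH : ∀ i j, ∑ k, G i k * H k j = if i = j then 1 else 0)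
    (m i j : Fin n) : ∑ k, G m k * christoffelSymbol d G H k i j
      = (1 / 2 : ℝ) • (d i (G j m) + d j (G i m) - d m (G i j)) := by
  simp only [christoffelSymbol, mul_smul_comm, ← Finset.smul_sum, Finset.mul_sum, ← mul_assoc]
  rw [Finset.sum_comm]
  simp only [← Finset.sum_mul, hGH]
  rw [Finset.sum_eq_single m (by intro l _ hl; simp [Ne.symm hl]) (by simp), if_pos rfl, one_mul]

lemma derivation_sum_smul_apply (X : Fin n → A) (a : A) :
    (∑ i, X i • d i) a = ∑ i, X i * d i a := by
  rw [← Derivation.coeFnAddMonoidHom_apply, map_sum]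
  simp

lemma deriv_eq_sum_christoffelSymbol (hG : ∀ i j, G i j = G j i)
    (hGH : ∀ i j, ∑ k, G i k * H k j = if i = j then 1 else 0) (k a b : Fin n) :
    d k (G a b) = ∑ m, G b m * christoffelSymbol d G H m k a
      + ∑ m, G a m * christoffelSymbol d G H m k b := by
  rw [sum_mul_christoffelSymbol hGH, sum_mul_christoffelSymbol hGH, ← smul_add, hG b a, ← sub_eq_zero]
  module

lemma sum_comm_reverse {α β γ N : Type*} [Fintype α] [Fintype β] [Fintype γ] [AddCommMonoid N]
    (F : α → β → γ → N) : ∑ i, ∑ j, ∑ k, F i j k = ∑ k, ∑ j, ∑ i, F i j k := by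
  rw [Finset.sum_comm]
  simp only [Finset.sum_comm (s := Finset.univ (α := α))]
  exact Finset.sum_comm

/-- The Levi-Civita connection of a metric given by its components in a coordinate frame. -/
def leviCivita (d : Fin n → Derivation ℝ A A) (hd : ∀ i j a, d i (d j a) = d j (d i a))
    (x : Fin n → A) (hx : ∀ i k, d i (x k) = if i = k then 1 else 0)
    (G H : Fin n → Fin n → A) (hG : ∀ i j, G i j = G j i) (hH : ∀ i j, H i j = H j i)
    (hGH : ∀ i j, ∑ k, G i k * H k j = if i = j then 1 else 0) :
    LeviCivita A (Fin n → A) (Fin n) where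
  act :=
    { toFun := fun X => ∑ i, X i • d i
      map_add' := fun X Y => by simp [add_smul, Finset.sum_add_distrib]
      map_smul' := fun a X => by simp [Finset.smul_sum, smul_smul] }
  nab :=
    { toFun := fun X =>
        { toFun := fun Y k =>
            ∑ i, X i * (d i (Y k) + ∑ l, christoffelSymbol d G H k i l * Y l)
          map_zero' := by ext; simp
          map_add' := fun Y Y' => by
            ext k
            simp only [Pi.add_apply, map_add, mul_add, Finset.sum_add_distrib]
            ring }
      map_add' := fun X X' => by
        ext Y k
        simp [add_mul, Finset.sum_add_distrib]
      map_smul' := fun a X => by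
        ext Y k
        simp [mul_assoc, Finset.mul_sum] }
  nab_smul X a Y := by
    ext k
    have h (i : Fin n) : ∑ l, christoffelSymbol d G H k i l * (a * Y l)
        = a * ∑ l, christoffelSymbol d G H k i l * Y l := by
      simp only [Finset.mul_sum, mul_left_comm]
    simp only [LinearMap.coe_mk, AddHom.coe_mk, AddMonoidHom.coe_mk, ZeroHom.coe_mk, Pi.add_apply,
      Pi.smul_apply, smul_eq_mul, derivation_sum_smul_apply, Derivation.leibniz, h,
      Finset.sum_mul]
    rw [Finset.mul_sum, ← Finset.sum_add_distrib]
    exact Finset.sum_congr rfl fun i _ => by ring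
  inner := LinearMap.mk₂ A (fun X Y => ∑ i, ∑ j, G i j * X i * Y j)
    (fun X X' Y => by simp [mul_add, add_mul, Finset.sum_add_distrib])
    (fun a X Y => by
      simp only [Pi.smul_apply, smul_eq_mul, Finset.mul_sum]
      exact Finset.sum_congr rfl fun i _ => Finset.sum_congr rfl fun j _ => by ring)
    (fun X Y Y' => by simp [mul_add, Finset.sum_add_distrib])
    (fun a X Y => by
      simp only [Pi.smul_apply, smul_eq_mul, Finset.mul_sum]
      exact Finset.sum_congr rfl fun i _ => Finset.sum_congr rfl fun j _ => by ring)
  inner_symm X Y := by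
    simp only [LinearMap.mk₂_apply]
    rw [Finset.sum_comm]
    refine Finset.sum_congr rfl fun i _ => Finset.sum_congr rfl fun j _ => ?_
    rw [hG]; ring
  act_inner X Y Z := by
    simp only [LinearMap.coe_mk, AddHom.coe_mk, AddMonoidHom.coe_mk, ZeroHom.coe_mk,
      derivation_sum_smul_apply, LinearMap.mk₂_apply]
    have h₁ (u : Fin n → Fin n → A) : ∑ i, ∑ j, G i j * (∑ k, X k * u k i) * Z j
        = ∑ k, X k * ∑ i, ∑ j, G i j * u k i * Z j := by
      simp only [Finset.mul_sum, Finset.sum_mul]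
      rw [sum_comm_reverse]
      refine Finset.sum_congr rfl fun k _ => ?_
      rw [Finset.sum_comm]
      exact Finset.sum_congr rfl fun i _ => Finset.sum_congr rfl fun j _ => by ring
    have h₂ (u : Fin n → Fin n → A) : ∑ i, ∑ j, G i j * Y i * (∑ k, X k * u k j)
        = ∑ k, X k * ∑ i, ∑ j, G i j * Y i * u k j := by
      simp only [Finset.mul_sum]
      rw [sum_comm_reverse]
      refine Finset.sum_congr rfl fun k _ => ?_
      rw [Finset.sum_comm]
      exact Finset.sum_congr rfl fun i _ => Finset.sum_congr rfl fun j _ => by ring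
    rw [h₁, h₂, ← Finset.sum_add_distrib]
    refine Finset.sum_congr rfl fun k _ => ?_
    rw [← mul_add]
    congr 1
    simp only [map_sum, Derivation.leibniz, smul_eq_mul, mul_add, add_mul, Finset.sum_add_distrib]
    -- After the Leibniz rule, compatibility is exactly the expression of `∂ₖ G` by Christoffel
    -- symbols.
    have h₃ : ∑ i, ∑ j, Z j * (Y i * d k (G i j))
        = ∑ i, ∑ j, G i j * (∑ l, christoffelSymbol d G H i k l * Y l) * Z j
          + ∑ i, ∑ j, G i j * Y i * (∑ l, christoffelSymbol d G H j k l * Z l) := by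
      simp only [Finset.mul_sum, Finset.sum_mul]
      rw [sum_comm_reverse, ← Finset.sum_add_distrib]
      refine Finset.sum_congr rfl fun a _ => ?_
      rw [Finset.sum_comm (f := fun j l => G a j * Y a * (christoffelSymbol d G H j k l * Z l)),
        ← Finset.sum_add_distrib]
      refine Finset.sum_congr rfl fun b _ => ?_
      rw [deriv_eq_sum_christoffelSymbol hG hGH, mul_add, mul_add]
      simp only [Finset.mul_sum]
      congr 1
      · exact Finset.sum_congr rfl fun m _ => by rw [hG b m]; ring
      · exact Finset.sum_congr rfl fun m _ => by ring
    rw [h₃]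
    simp only [mul_comm (Z _), mul_assoc]
    abel
  act_act X Y a := by
    have h₁ (X Y : Fin n → A) : ∑ i, X i * d i (∑ j, Y j * d j a)
        = ∑ j, (∑ i, X i * d i (Y j)) * d j a + ∑ i, ∑ j, X i * Y j * d i (d j a) := by
      simp only [map_sum, Derivation.leibniz, smul_eq_mul, Finset.mul_sum, Finset.sum_mul]
      rw [Finset.sum_comm (f := fun j i => X i * d i (Y j) * d j a)]
      simp only [← Finset.sum_add_distrib]
      exact Finset.sum_congr rfl fun i _ => Finset.sum_congr rfl fun j _ => by ring
    have h₂ : ∑ i, ∑ j, X i * Y j * d i (d j a) = ∑ i, ∑ j, Y i * X j * d i (d j a) := by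
      rw [Finset.sum_comm]
      refine Finset.sum_congr rfl fun i _ => Finset.sum_congr rfl fun j _ => ?_
      rw [hd]; ring
    have h₃ (k : Fin n) : ∑ i, ∑ l, X i * (christoffelSymbol d G H k i l * Y l)
        = ∑ i, ∑ l, Y i * (christoffelSymbol d G H k i l * X l) := by
      rw [Finset.sum_comm]
      refine Finset.sum_congr rfl fun i _ => Finset.sum_congr rfl fun j _ => ?_
      rw [christoffelSymbol_symm hG]; ring
    simp only [LinearMap.coe_mk, AddHom.coe_mk, AddMonoidHom.coe_mk, ZeroHom.coe_mk,
      derivation_sum_smul_apply, Pi.sub_apply, mul_add, Finset.sum_add_distrib, h₁, h₂]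
    rw [add_sub_add_right_eq_sub, ← Finset.sum_sub_distrib]
    refine Finset.sum_congr rfl fun k _ => ?_
    rw [← sub_mul]
    simp only [Finset.mul_sum, h₃, add_sub_add_right_eq_sub]
  -- A field is recovered from its action on the coordinate functions.
  act_faithful X h := by
    ext k
    simpa [hx, derivation_sum_smul_apply] using h (x k)
  frame i := Pi.single i 1
  cometric := H
  cometric_symm := hH
  reconstruct v := by
    ext k
    simp only [LinearMap.mk₂_apply, Finset.sum_apply, Pi.smul_apply, smul_eq_mul, Pi.single_apply,
      mul_ite, mul_one, mul_zero, Finset.sum_ite_eq', Finset.mem_univ, if_true]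
    rw [Finset.sum_comm]
    simp only [Finset.sum_ite_eq, Finset.mem_univ, if_true, Finset.mul_sum]
    rw [Finset.sum_comm]
    have h (i : Fin n) : ∑ j, H k j * (G i j * v i) = (∑ j, G i j * H j k) * v i := by
      rw [Finset.sum_mul]
      exact Finset.sum_congr rfl fun j _ => by rw [hH k j]; ring
    simp [h, hGH]

end LeviCivitaOfMatrix

/-! ### Dictionary between invariant operators and coordinate formulas. -/

section Chart

variable {n : ℕ}

/-- Evaluation of smooth functions at a point. -/
def evalAt {U : Set (EuclideanSpace ℝ (Fin n))} (z : U) : smoothFun U →ₐ[ℝ] ℝ :=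
  (Pi.evalAlgHom ℝ _ z).comp (smoothFun U).val

lemma ext_evalAt {U : Set (EuclideanSpace ℝ (Fin n))} {a b : smoothFun U}
    (h : ∀ z, evalAt z a = evalAt z b) : a = b := smoothFun_ext h

lemma evalAt_toSmooth {U : Set (EuclideanSpace ℝ (Fin n))} {φ : EuclideanSpace ℝ (Fin n) → ℝ}
    (h : ContDiffOn ℝ ∞ φ U) (z : U) : evalAt z (toSmooth φ h) = φ z := rfl

lemma evalAt_partialDer {U : Set (EuclideanSpace ℝ (Fin n))} (hU : IsOpen U) (i : Fin n)
    {a : smoothFun U} {φ : EuclideanSpace ℝ (Fin n) → ℝ} (h : ∀ z : U, evalAt z a = φ z) (z : U) :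
    evalAt z (partialDer hU i a) = pderiv i φ z :=
  partialDer_of_eq hU i h z

/-- `G` is the component matrix of a smooth nondegenerate metric on the open set `U`. -/
structure IsMetricOn (U : Set (EuclideanSpace ℝ (Fin n)))
    (G : EuclideanSpace ℝ (Fin n) → Matrix (Fin n) (Fin n) ℝ) : Prop where
  isOpen : IsOpen U
  contDiffOn : ∀ i j, ContDiffOn ℝ ∞ (fun z => G z i j) U
  symm : ∀ z ∈ U, (G z).IsSymm
  isUnit_det : ∀ z ∈ U, IsUnit (G z).det

namespace IsMetricOn

variable {U : Set (EuclideanSpace ℝ (Fin n))}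
  {G : EuclideanSpace ℝ (Fin n) → Matrix (Fin n) (Fin n) ℝ} (hG : IsMetricOn U G)

include hG in
lemma contDiffOn_inv (i j : Fin n) : ContDiffOn ℝ ∞ (fun z => (G z)⁻¹ i j) U := by
  have hdet (F : EuclideanSpace ℝ (Fin n) → Matrix (Fin n) (Fin n) ℝ)
      (hF : ∀ i j, ContDiffOn ℝ ∞ (fun z => F z i j) U) : ContDiffOn ℝ ∞ (fun z => (F z).det) U := by
    simp only [Matrix.det_apply]
    exact ContDiffOn.sum fun σ _ => (contDiffOn_prod fun k _ => hF _ _).const_smul _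
  have hinv : ContDiffOn ℝ ∞ (fun z => ((G z).det)⁻¹) U :=
    (hdet G hG.contDiffOn).inv fun z hz => (hG.isUnit_det z hz).ne_zero
  -- Cramer's rule: an adjugate entry is the determinant of `G` with one row replaced by a basis
  -- vector.
  simp only [Matrix.inv_def, Ring.inverse_eq_inv', Matrix.smul_apply, Matrix.adjugate_apply,
    smul_eq_mul]
  refine hinv.mul (hdet _ fun k l => ?_)
  by_cases h : k = j
  · subst h
    simpa [Matrix.updateRow_self] using contDiffOn_const
  · simpa [Matrix.updateRow_ne h] using hG.contDiffOn k l

/-- The Levi-Civita connection of a metric on an open subset of `ℝⁿ`. -/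
def connection : LeviCivita (smoothFun U) (Fin n → smoothFun U) (Fin n) :=
  leviCivita (partialDer hG.isOpen) (partialDer_comm hG.isOpen) (coordFun U)
    (partialDer_coordFun hG.isOpen) (fun i j => toSmooth _ (hG.contDiffOn i j))
    (fun i j => toSmooth _ (hG.contDiffOn_inv i j))
    (fun i j => smoothFun_ext fun z => (hG.symm z z.2).apply j i)
    (fun i j => smoothFun_ext fun z => by
      have h := Matrix.IsSymm.ext_iff.1 (hG.symm z z.2)
      change (G z)⁻¹ i j = (G z)⁻¹ j i
      have := Matrix.transpose_nonsing_inv (G z)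
      rw [(hG.symm z z.2).eq] at this
      conv_lhs => rw [← this]
      rfl)
    (fun i j => smoothFun_ext fun z => by
      change evalAt z _ = evalAt z _
      have h := congrArg (fun M => M i j) (Matrix.mul_nonsing_inv (G z) (hG.isUnit_det z z.2))
      simp only [Matrix.mul_apply, Matrix.one_apply] at h
      simp only [map_sum, map_mul, evalAt_toSmooth, h]
      split_ifs <;> simp)

/-- The Christoffel symbols of the connection. -/
def gamma (k i j : Fin n) : smoothFun U :=
  christoffelSymbol (partialDer hG.isOpen) (fun i j => toSmooth _ (hG.contDiffOn i j))
    (fun i j => toSmooth _ (hG.contDiffOn_inv i j)) k i j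

lemma evalAt_gamma (z : U) (k i j : Fin n) : evalAt z (hG.gamma k i j) = christoffel G z k i j := by
  simp only [gamma, christoffelSymbol, christoffel, map_smul, map_sum, map_mul, map_add, map_sub,
    evalAt_toSmooth, smul_eq_mul]
  have h (l i j : Fin n) := evalAt_partialDer hG.isOpen l (φ := fun z => G z i j)
    (evalAt_toSmooth (hG.contDiffOn i j)) z
  simp only [h]

lemma gamma_symm (k i j : Fin n) : hG.gamma k i j = hG.gamma k j i :=
  christoffelSymbol_symm (fun i j => smoothFun_ext fun z => (hG.symm z z.2).apply j i) k i j

lemma nab_apply (X Y : Fin n → smoothFun U) (k : Fin n) : (connection hG).nab X Y k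
    = ∑ i, X i * (partialDer hG.isOpen i (Y k) + ∑ l, hG.gamma k i l * Y l) := rfl

lemma frame_apply (i k : Fin n) : hG.connection.frame i k = if k = i then 1 else 0 :=
  Pi.single_apply i 1 k

lemma act_apply (X : Fin n → smoothFun U) (a : smoothFun U) :
    hG.connection.act X a = ∑ i, X i * partialDer hG.isOpen i a :=
  derivation_sum_smul_apply X a

lemma act_frame (i : Fin n) (a : smoothFun U) :
    hG.connection.act (hG.connection.frame i) a = partialDer hG.isOpen i a := by
  rw [act_apply]
  simp [frame_apply]

lemma nab_frame_apply (i k : Fin n) (Y : Fin n → smoothFun U) :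
    hG.connection.nab (hG.connection.frame i) Y k
      = partialDer hG.isOpen i (Y k) + ∑ l, hG.gamma k i l * Y l := by
  rw [nab_apply]
  simp [frame_apply]

lemma nab_frame_frame (i j : Fin n) :
    hG.connection.nab (hG.connection.frame i) (hG.connection.frame j)
      = fun k => hG.gamma k i j := by
  ext k
  rw [nab_frame_apply]
  simp only [frame_apply]
  split_ifs <;> simp

lemma inner_apply (X Y : Fin n → smoothFun U) : hG.connection.inner X Y
    = ∑ i, ∑ j, toSmooth _ (hG.contDiffOn i j) * X i * Y j := rfl

lemma cometric_apply (i j : Fin n) :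
    hG.connection.cometric i j = toSmooth _ (hG.contDiffOn_inv i j) := rfl

lemma map_eq_sum {N : Type*} [AddCommGroup N] [Module (smoothFun U) N]
    (L : (Fin n → smoothFun U) →ₗ[smoothFun U] N) (X : Fin n → smoothFun U) :
    L X = ∑ k, X k • L (hG.connection.frame k) := by
  have h : X = ∑ k, X k • hG.connection.frame k := by
    ext k
    simp [frame_apply]
  conv_lhs => rw [h]
  simp

lemma nab_nab_frame (i j : Fin n) (Y : Fin n → smoothFun U) :
    hG.connection.nab (hG.connection.nab (hG.connection.frame i) (hG.connection.frame j)) Y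
      = ∑ l, hG.gamma l i j • hG.connection.nab (hG.connection.frame l) Y := by
  have h := hG.map_eq_sum (hG.connection.endo Y)
    (hG.connection.nab (hG.connection.frame i) (hG.connection.frame j))
  rw [nab_frame_frame] at h
  rw [nab_frame_frame]
  exact h

lemma evalAt_tr (z : U) (T : (Fin n → smoothFun U) → (Fin n → smoothFun U) → smoothFun U) :
    evalAt z (hG.connection.tr T) = ∑ i, ∑ j, (G z)⁻¹ i j *
      evalAt z (T (hG.connection.frame i) (hG.connection.frame j)) := by
  simp [LeviCivita.tr, cometric_apply, evalAt_toSmooth]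

lemma tr_apply (T : (Fin n → smoothFun U) → (Fin n → smoothFun U) → Fin n → smoothFun U)
    (k : Fin n) : hG.connection.tr T k = hG.connection.tr fun a b => T a b k := by
  simp [LeviCivita.tr]

lemma evalAt_inner_frame (z : U) (X : Fin n → smoothFun U) (j : Fin n) :
    evalAt z (hG.connection.inner X (hG.connection.frame j)) = ∑ i, G z j i * evalAt z (X i) := by
  have h (i : Fin n) : G z j i = G z i j := (hG.symm z z.2).apply i j
  simp [inner_apply, frame_apply, evalAt_toSmooth, h]

lemma evalAt_inner_frame_frame (z : U) (i j : Fin n) :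
    evalAt z (hG.connection.inner (hG.connection.frame i) (hG.connection.frame j)) = G z i j := by
  simp [inner_apply, frame_apply, evalAt_toSmooth]

lemma apply_eq_sum_inner_frame (X : Fin n → smoothFun U) (k : Fin n) :
    X k = ∑ j, hG.connection.cometric k j * hG.connection.inner X (hG.connection.frame j) := by
  conv_lhs => rw [← hG.connection.reconstruct X]
  simp only [Finset.sum_apply, Pi.smul_apply, smul_eq_mul, frame_apply, mul_ite, mul_one, mul_zero]
  rw [Finset.sum_comm]
  simp

section Vector

variable {Y : Fin n → smoothFun U} {w : EuclideanSpace ℝ (Fin n) → Fin n → ℝ}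
  (hY : ∀ (z : U) k, evalAt z (Y k) = w z k)
include hY

lemma evalAt_nab_frame (z : U) (i k : Fin n) :
    evalAt z (hG.connection.nab (hG.connection.frame i) Y k) = covVec G w z i k := by
  simp only [nab_frame_apply, map_add, map_sum, map_mul, evalAt_gamma, hY, covVec]
  rw [evalAt_partialDer hG.isOpen i (φ := fun z => w z k) (hY · k)]

lemma evalAt_nab {X : Fin n → smoothFun U} {v : EuclideanSpace ℝ (Fin n) → Fin n → ℝ}
    (hX : ∀ (z : U) k, evalAt z (X k) = v z k) (z : U) (k : Fin n) :
    evalAt z (hG.connection.nab X Y k) = covVecAlong G v w z k := by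
  have h := congrFun (hG.map_eq_sum (hG.connection.endo Y) X) k
  rw [LeviCivita.endo_apply] at h
  simp only [h, covVecAlong, LeviCivita.endo_apply, Finset.sum_apply, Pi.smul_apply, smul_eq_mul,
    map_sum, map_mul, hX, hG.evalAt_nab_frame hY]

lemma evalAt_hess (z : U) (a i k : Fin n) :
    evalAt z (hG.connection.hess Y (hG.connection.frame a) (hG.connection.frame i) k)
      = covVec₂ G w z a i k := by
  rw [LeviCivita.hess_apply, nab_nab_frame, Pi.sub_apply, nab_frame_apply]
  simp only [Finset.sum_apply, Pi.smul_apply, smul_eq_mul, map_sub, map_add, map_sum, map_mul,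
    hG.evalAt_nab_frame hY, evalAt_gamma, covVec₂]
  rw [evalAt_partialDer hG.isOpen a (φ := fun z => covVec G w z i k)
    (hG.evalAt_nab_frame hY · i k), Finset.sum_sub_distrib]
  ring

lemma evalAt_lap (z : U) (k : Fin n) :
    evalAt z (hG.connection.lap Y k) = laplacianVec G w z k := by
  simp only [LeviCivita.lap, tr_apply, evalAt_tr, hG.evalAt_hess hY, laplacianVec]

end Vector

lemma evalAt_curv (z : U) (m l i j : Fin n) :
    evalAt z (hG.connection.curv (hG.connection.frame i) (hG.connection.frame j)
      (hG.connection.frame l) m) = riemannUp G z m l i j := by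
  have h : hG.connection.nab (hG.connection.frame i) (hG.connection.frame j)
      - hG.connection.nab (hG.connection.frame j) (hG.connection.frame i) = 0 := by
    rw [nab_frame_frame, nab_frame_frame, sub_eq_zero]
    exact funext fun k => hG.gamma_symm k i j
  rw [LeviCivita.curv_apply, h, map_zero, nab_frame_frame, nab_frame_frame]
  simp only [Pi.sub_apply, AddMonoidHom.zero_apply, Pi.zero_apply, sub_zero, nab_frame_apply,
    map_sub, map_add, map_sum, map_mul, evalAt_gamma, riemannUp]
  rw [evalAt_partialDer hG.isOpen i (φ := fun z => christoffel G z m j l)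
      (hG.evalAt_gamma · m j l), evalAt_partialDer hG.isOpen j
      (φ := fun z => christoffel G z m i l) (hG.evalAt_gamma · m i l), Finset.sum_sub_distrib]
  ring

lemma evalAt_inner_curv (z : U) (i j k l : Fin n) :
    evalAt z (hG.connection.inner (hG.connection.curv (hG.connection.frame i)
      (hG.connection.frame j) (hG.connection.frame l)) (hG.connection.frame k))
      = riemann G z i j k l := by
  simp only [evalAt_inner_frame, evalAt_curv, riemann]

lemma evalAt_inner_ric (z : U) (i k : Fin n) :
    evalAt z (hG.connection.inner (hG.connection.ric (hG.connection.frame i))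
      (hG.connection.frame k)) = ricci G z i k := by
  rw [LeviCivita.ric_apply, LeviCivita.inner_symm, LeviCivita.map_tr, evalAt_tr]
  simp only [hG.connection.inner_symm (hG.connection.frame k), evalAt_inner_curv, ricci]

lemma evalAt_ric (z : U) (p i : Fin n) :
    evalAt z (hG.connection.ric (hG.connection.frame i) p) = ricciEndo G z p i := by
  rw [hG.apply_eq_sum_inner_frame (hG.connection.ric _)]
  simp only [map_sum, map_mul, cometric_apply, evalAt_toSmooth, evalAt_inner_ric, ricciEndo]

lemma sum_mul_sum_mul (a R h : Fin n → Fin n → ℝ) :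
    ∑ j, ∑ p, a j p * ∑ l, ∑ q, a l q * (R j l * h p q)
      = ∑ j, ∑ l, ∑ p, ∑ q, a j p * a l q * R j l * h p q := by
  simp only [Finset.mul_sum]
  refine Finset.sum_congr rfl fun j _ => ?_
  rw [Finset.sum_comm]
  refine Finset.sum_congr rfl fun l _ => Finset.sum_congr rfl fun p _ =>
    Finset.sum_congr rfl fun q _ => ?_
  ring

section Tensor

variable {T : (Fin n → smoothFun U) →ₗ[smoothFun U] (Fin n → smoothFun U) →ₗ[smoothFun U]
    smoothFun U} {h : EuclideanSpace ℝ (Fin n) → Matrix (Fin n) (Fin n) ℝ}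
  (hT : ∀ (z : U) i j, evalAt z (T (hG.connection.frame i) (hG.connection.frame j)) = h z i j)
include hT

/-- The invariant formula uses `D`, the coordinate one does not: by symmetry of `Γ`, `D_{∂ᵢ} X` is
`D_X ∂ᵢ` plus the plain derivatives `∂ᵢ Xᵏ`, and the `D_X ∂ᵢ` terms cancel. -/
lemma evalAt_lie {X : Fin n → smoothFun U} {v : EuclideanSpace ℝ (Fin n) → Fin n → ℝ}
    (hX : ∀ (z : U) k, evalAt z (X k) = v z k) (z : U) (i j : Fin n) :
    evalAt z (hG.connection.lie X T (hG.connection.frame i) (hG.connection.frame j))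
      = lieDeriv v h z i j := by
  have bracket (i : Fin n) : hG.connection.nab (hG.connection.frame i) X
      = hG.connection.nab X (hG.connection.frame i)
        + fun k => partialDer hG.isOpen i (X k) := by
    funext k
    rw [Pi.add_apply, nab_frame_apply, nab_apply, add_comm]
    congr 1
    refine Finset.sum_congr rfl fun j _ => ?_
    have h : partialDer hG.isOpen j (hG.connection.frame i k) = 0 := by
      rw [frame_apply]; split_ifs <;> simp
    rw [h]
    simp [frame_apply, hG.gamma_symm k i j, mul_comm]
  have h₁ (X Z : Fin n → smoothFun U) : T X Z = ∑ k, X k • T (hG.connection.frame k) Z :=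
    hG.map_eq_sum (T.flip Z) X
  have h₂ (X Z : Fin n → smoothFun U) : T Z X = ∑ k, X k • T Z (hG.connection.frame k) :=
    hG.map_eq_sum (T Z) X
  have hd (i k : Fin n) := evalAt_partialDer hG.isOpen i (φ := fun z => v z k) (hX · k) z
  have hd' (k : Fin n) := evalAt_partialDer hG.isOpen k (φ := fun z => h z i j) (hT · i j) z
  have hsum : hG.connection.lie X T (hG.connection.frame i) (hG.connection.frame j)
      = hG.connection.act X (T (hG.connection.frame i) (hG.connection.frame j))
        + T (fun k => partialDer hG.isOpen i (X k)) (hG.connection.frame j)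
        + T (hG.connection.frame i) (fun k => partialDer hG.isOpen j (X k)) := by
    rw [LeviCivita.lie, LeviCivita.cov_apply, bracket, bracket, map_add, map_add,
      LinearMap.add_apply]
    ring
  rw [hsum, h₁ (fun k => partialDer hG.isOpen i (X k)),
    h₂ (fun k => partialDer hG.isOpen j (X k)), act_apply]
  simp only [map_add, map_sum, smul_eq_mul, map_mul, hT, hX, hd, hd', lieDeriv, Matrix.of_apply,
    Finset.sum_add_distrib]

lemma evalAt_cov (z : U) (a i j : Fin n) :
    evalAt z (hG.connection.cov T (hG.connection.frame a) (hG.connection.frame i)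
      (hG.connection.frame j)) = covTensor G h z a i j := by
  have h₁ (X Z : Fin n → smoothFun U) : T X Z = ∑ k, X k • T (hG.connection.frame k) Z :=
    hG.map_eq_sum (T.flip Z) X
  have h₂ (X Z : Fin n → smoothFun U) : T Z X = ∑ k, X k • T Z (hG.connection.frame k) :=
    hG.map_eq_sum (T Z) X
  rw [LeviCivita.cov_apply, nab_frame_frame, nab_frame_frame, h₁ (fun k => hG.gamma k a i),
    h₂ (fun k => hG.gamma k a j), act_frame]
  simp only [map_sub, map_sum, smul_eq_mul, map_mul, hT, evalAt_gamma, covTensor,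
    Finset.sum_add_distrib]
  rw [evalAt_partialDer hG.isOpen a (φ := fun z => h z i j) (hT · i j)]
  ring

lemma evalAt_cov₂ (z : U) (b a i j : Fin n) :
    evalAt z (hG.connection.cov₂ T (hG.connection.frame b) (hG.connection.frame a)
      (hG.connection.frame i) (hG.connection.frame j)) = covTensor₂ G h z b a i j := by
  have h₁ (X Y Z : Fin n → smoothFun U) : hG.connection.cov T X Y Z
      = ∑ k, X k • hG.connection.cov T (hG.connection.frame k) Y Z :=
    hG.map_eq_sum (((hG.connection.cov T).flip Y).flip Z) X
  have h₂ (X Y Z : Fin n → smoothFun U) : hG.connection.cov T Y X Z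
      = ∑ k, X k • hG.connection.cov T Y (hG.connection.frame k) Z :=
    hG.map_eq_sum ((hG.connection.cov T Y).flip Z) X
  have h₃ (X Y Z : Fin n → smoothFun U) : hG.connection.cov T Y Z X
      = ∑ k, X k • hG.connection.cov T Y Z (hG.connection.frame k) :=
    hG.map_eq_sum (hG.connection.cov T Y Z) X
  rw [LeviCivita.cov₂, nab_frame_frame, nab_frame_frame, nab_frame_frame,
    h₁ (fun k => hG.gamma k b a), h₂ (fun k => hG.gamma k b i), h₃ (fun k => hG.gamma k b j),
    act_frame]
  simp only [map_sub, map_sum, smul_eq_mul, map_mul, hG.evalAt_cov hT, evalAt_gamma, covTensor₂,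
    Finset.sum_add_distrib]
  rw [evalAt_partialDer hG.isOpen b (φ := fun z => covTensor G h z a i j)
    (hG.evalAt_cov hT · a i j)]
  ring

lemma evalAt_lich (z : U) (i k : Fin n) :
    evalAt z (hG.connection.lich T (hG.connection.frame i) (hG.connection.frame k))
      = lichnerowicz G h z i k := by
  have h₁ (X Z : Fin n → smoothFun U) : T X Z = ∑ k, X k • T (hG.connection.frame k) Z :=
    hG.map_eq_sum (T.flip Z) X
  have h₂ (X Z : Fin n → smoothFun U) : T Z X = ∑ k, X k • T Z (hG.connection.frame k) :=
    hG.map_eq_sum (T Z) X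
  rw [LeviCivita.lich, h₁ (hG.connection.ric _), h₂ (hG.connection.ric _)]
  simp only [map_sub, map_add, map_sum, map_mul, map_ofNat, smul_eq_mul, evalAt_tr,
    hG.evalAt_cov₂ hT, evalAt_inner_curv, evalAt_ric, hT, lichnerowicz, laplacianTensor]
  congr! 4
  exact sum_mul_sum_mul (fun i j => (G z)⁻¹ i j) (fun j l => riemann G z i j k l)
    (fun p q => h z p q)

end Tensor

end IsMetricOn

end Chart

variable {n : ℕ}

/-- The components of `Δ_L h + ℒ_X h - h` vanish, for a solution in coordinates. -/
theorem IsMetricOn.lichnerowicz_lieDeriv_eq_zero {U : Set (EuclideanSpace ℝ (Fin n))}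
    {G : EuclideanSpace ℝ (Fin n) → Matrix (Fin n) (Fin n) ℝ} (hG : IsMetricOn U G)
    {f : EuclideanSpace ℝ (Fin n) → ℝ} (hf : ContDiffOn ℝ ∞ f U)
    {W : EuclideanSpace ℝ (Fin n) → Fin n → ℝ} (hW : ∀ k, ContDiffOn ℝ ∞ (fun z => W z k) U)
    (hsol : ∀ y ∈ U, ∀ i j, 2 * ricci G y i j + G y i j = lieDeriv (gradient G f) G y i j)
    (hWeq : ∀ y ∈ U, ∀ k, laplacianVec G W y k + covVecAlong G (gradient G f) W y k
      - (1 / 2 : ℝ) * W y k = 0) {y : EuclideanSpace ℝ (Fin n)} (hy : y ∈ U) (i k : Fin n) :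
    lichnerowicz G (lieDeriv W G) y i k + lieDeriv (gradient G f) (lieDeriv W G) y i k
      - lieDeriv W G y i k = 0 := by
  set C := hG.connection with hC
  let fs : smoothFun U := toSmooth f hf
  let w : Fin n → smoothFun U := fun k => toSmooth _ (hW k)
  have hw (z : U) (k : Fin n) : evalAt z (w k) = W z k := rfl
  set X := C.grad fs with hXdef
  have hX (z : U) (k : Fin n) : evalAt z (X k) = gradient G f z k := by
    have h : X k = ∑ j, C.cometric k j * partialDer hG.isOpen j fs := by
      simp only [hXdef, LeviCivita.grad, hC, hG.act_frame, Finset.sum_apply, Pi.smul_apply,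
        smul_eq_mul, hG.frame_apply, mul_ite, mul_one, mul_zero]
      rw [Finset.sum_comm]
      simp
    simp only [h, map_sum, map_mul, gradient, hC, hG.cometric_apply, evalAt_toSmooth,
      evalAt_partialDer hG.isOpen _ (a := fs) (φ := f) (fun _ => rfl)]
  have hh (z : U) (i j : Fin n) : evalAt z (C.lieInner w (C.frame i) (C.frame j))
      = lieDeriv W G z i j := by
    rw [← C.lie_inner]
    exact hG.evalAt_lie hG.evalAt_inner_frame_frame hw z i j
  have hsol' (i j : Fin n) : 2 * C.inner (C.ric (C.frame i)) (C.frame j)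
      + C.inner (C.frame i) (C.frame j) = C.lieInner X (C.frame i) (C.frame j) := by
    -- The equation must hold at all points of `U`, as an identity of functions, because it is
    -- differentiated later.
    refine ext_evalAt fun z => ?_
    rw [← LeviCivita.lie_inner, hG.evalAt_lie hG.evalAt_inner_frame_frame hX, map_add, map_mul,
      hG.evalAt_inner_ric, hG.evalAt_inner_frame_frame, ← hsol z z.2, map_ofNat]
  have hW' : (2 : smoothFun U) • C.lap w + (2 : smoothFun U) • C.nab X w = w := by
    funext k
    refine ext_evalAt fun z => ?_
    have h := hWeq z z.2 k
    simp only [Pi.add_apply, Pi.smul_apply, smul_eq_mul, map_add, map_mul, map_ofNat,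
      hC, hG.evalAt_lap hw, hG.evalAt_nab hw hX, hw]
    linarith
  have main := congrArg (evalAt ⟨y, hy⟩)
    (C.lich_lieInner_add_lie hsol' hW' (C.frame i) (C.frame k))
  rw [map_sub, map_add, hG.evalAt_lich hh, hG.evalAt_lie hh hX, hh, map_zero] at main
  exact main

/-! ### Smoothness and nondegeneracy of components in a chart. -/

section Manifold

variable {M : Type*} [TopologicalSpace M] [ChartedSpace (EuclideanSpace ℝ (Fin n)) M]

lemma contDiffOn_comp_symm {f : M → ℝ} (hf : ContMDiff (𝓡 n) 𝓘(ℝ, ℝ) ∞ f)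
    {e : OpenPartialHomeomorph M (EuclideanSpace ℝ (Fin n))}
    (he : e ∈ IsManifold.maximalAtlas (𝓡 n) ∞ M) :
    ContDiffOn ℝ ∞ (fun z => f (e.symm z)) e.target :=
  (hf.comp_contMDiffOn (contMDiffOn_symm_of_mem_maximalAtlas he)).contDiffOn

variable [IsManifold (𝓡 n) ∞ M]

/-- The coordinate field is the tangent map of `e.symm` applied to a constant field. -/
lemma contMDiffOn_coordVec {e : OpenPartialHomeomorph M (EuclideanSpace ℝ (Fin n))}
    (he : e ∈ IsManifold.maximalAtlas (𝓡 n) ∞ M) (i : Fin n) :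
    ContMDiffOn 𝓘(ℝ, EuclideanSpace ℝ (Fin n)) (𝓡 n).tangent ∞
      (fun y => (⟨e.symm y, coordVec e y i⟩ : TangentBundle (𝓡 n) M)) e.target := by
  have : IsManifold (𝓡 n) 1 M := IsManifold.of_le (n := ∞) (by simp)
  have h := (contMDiffOn_symm_of_mem_maximalAtlas he).contMDiffOn_tangentMapWithin (m := ∞)
    (by simp) e.open_target.uniqueMDiffOn
  have hc : ContMDiffOn (𝓡 n) (𝓡 n).tangent ∞ (fun y => (⟨y, EuclideanSpace.single i (1 : ℝ)⟩ :
      TangentBundle (𝓡 n) (EuclideanSpace ℝ (Fin n)))) e.target :=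
    contMDiffOn_vectorSpace_iff_contDiffOn.2 contDiffOn_const
  refine (h.comp hc fun y hy => hy).congr fun y hy => ?_
  simp only [Function.comp_apply, tangentMapWithin, coordVec,
    mfderivWithin_of_isOpen e.open_target hy]

lemma contDiffOn_vecIn {W : ∀ x : M, TangentSpace (𝓡 n) x}
    (hW : ContMDiff (𝓡 n) (𝓡 n).tangent ∞ (fun x => (⟨x, W x⟩ : TangentBundle (𝓡 n) M)))
    {e : OpenPartialHomeomorph M (EuclideanSpace ℝ (Fin n))}
    (he : e ∈ IsManifold.maximalAtlas (𝓡 n) ∞ M) (k : Fin n) :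
    ContDiffOn ℝ ∞ (fun y => vecIn W e y k) e.target := by
  have : IsManifold (𝓡 n) 1 M := IsManifold.of_le (n := ∞) (by simp)
  have h := (contMDiffOn_of_mem_maximalAtlas he).contMDiffOn_tangentMapWithin (m := ∞)
    (by simp) e.open_source.uniqueMDiffOn
  have hc := (h.comp hW.contMDiffOn (fun x hx => hx)).comp
    (contMDiffOn_symm_of_mem_maximalAtlas he) fun y hy => e.map_target hy
  have hd : ContMDiffOn (𝓡 n) (𝓡 n).tangent ∞ (fun y =>
      (⟨y, mfderiv (𝓡 n) (𝓡 n) e (e.symm y) (W (e.symm y))⟩ :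
        TangentBundle (𝓡 n) (EuclideanSpace ℝ (Fin n)))) e.target := by
    refine hc.congr fun y hy => ?_
    simp only [Function.comp_apply, tangentMapWithin,
      mfderivWithin_of_isOpen e.open_source (e.map_target hy)]
    rw [e.right_inv hy]
  exact (EuclideanSpace.proj (𝕜 := ℝ) k).contDiff.comp_contDiffOn
    (contMDiffOn_vectorSpace_iff_contDiffOn.1 hd)

/-- A kernel vector `v` of the Gram matrix gives a tangent vector `∑ vⁱ ∂ᵢ` of zero length, which
vanishes by positivity; injectivity of the differential of `e.symm` then forces `v = 0`. -/
lemma isMetricOn_metricIn (g : Bundle.ContMDiffRiemannianMetric (𝓡 n) ∞ (EuclideanSpace ℝ (Fin n))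
      (fun x : M => TangentSpace (𝓡 n) x))
    {e : OpenPartialHomeomorph M (EuclideanSpace ℝ (Fin n))}
    (he : e ∈ IsManifold.maximalAtlas (𝓡 n) ∞ M) : IsMetricOn e.target (metricIn g e) where
  isOpen := e.open_target
  contDiffOn i j := by
    have h : ContMDiffOn 𝓘(ℝ, EuclideanSpace ℝ (Fin n)) ((𝓡 n).prod 𝓘(ℝ)) ∞
        (fun y => Bundle.TotalSpace.mk' ℝ (E := Bundle.Trivial M ℝ) (e.symm y)
          (g.inner (e.symm y) (coordVec e y i) (coordVec e y j))) e.target := by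
      apply ContMDiffOn.clm_bundle_apply₂ (F₁ := EuclideanSpace ℝ (Fin n))
        (F₂ := EuclideanSpace ℝ (Fin n))
      · exact g.contMDiff.comp_contMDiffOn (contMDiffOn_symm_of_mem_maximalAtlas he)
      · exact contMDiffOn_coordVec he i
      · exact contMDiffOn_coordVec he j
    exact ContMDiffOn.contDiffOn fun y hy => (Bundle.contMDiffWithinAt_totalSpace.1 (h y hy)).2
  symm z _ := Matrix.IsSymm.ext fun i j => g.symm _ _ _
  isUnit_det z hz := by
    have : IsManifold (𝓡 n) 1 M := IsManifold.of_le (n := ∞) (by simp)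
    have hd : e.MDifferentiable (𝓡 n) (𝓡 n) :=
      ⟨(contMDiffOn_of_mem_maximalAtlas he).mdifferentiableOn (by simp),
        (contMDiffOn_symm_of_mem_maximalAtlas he).mdifferentiableOn (by simp)⟩
    have hinj := hd.symm.mfderiv_injective hz
    rw [isUnit_iff_ne_zero]
    intro h0
    obtain ⟨v, hv, hv0⟩ := Matrix.exists_mulVec_eq_zero_iff.2 h0
    have hu : g.inner (e.symm z) (∑ i, v i • coordVec e z i) (∑ i, v i • coordVec e z i) = 0 := by
      have h (i : Fin n) : ∑ j, metricIn g e z i j * v j = 0 := congrFun hv0 i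
      simp only [map_sum, map_smul, sum_apply, smul_apply, smul_eq_mul]
      refine Finset.sum_eq_zero fun i _ => ?_
      rw [← mul_zero (v i), ← h i]
      congr 1
      refine Finset.sum_congr rfl fun j _ => ?_
      rw [mul_comm, g.symm]
      rfl
    have hu0 : ∑ i, v i • coordVec e z i = 0 := by
      by_contra h
      exact (g.pos _ _ h).ne' hu
    let L : EuclideanSpace ℝ (Fin n) →L[ℝ] TangentSpace (𝓡 n) (e.symm z) :=
      mfderiv (𝓡 n) (𝓡 n) e.symm z
    have hsum : L (∑ i, v i • EuclideanSpace.single i (1 : ℝ)) = L 0 := by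
      rw [map_sum, map_zero]
      simp only [map_smul]
      exact hu0
    have hzero : ∑ i, v i • EuclideanSpace.single i (1 : ℝ) = 0 := hinj hsum
    refine hv (funext fun k => ?_)
    have hk := congrArg (fun w : EuclideanSpace ℝ (Fin n) => w k) hzero
    simpa [Finset.sum_apply, Pi.single_apply] using hk

end Manifold
end RicciSoliton

end

theorem proposition3p1 {n : ℕ} {M : Type*} [TopologicalSpace M]
    [ChartedSpace (EuclideanSpace ℝ (Fin n)) M] [IsManifold (𝓡 n) ∞ M]
    (g : Bundle.ContMDiffRiemannianMetric (𝓡 n) ∞ (EuclideanSpace ℝ (Fin n))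
      (fun x : M => TangentSpace (𝓡 n) x))
    (f : M → ℝ) (hsol : RicciSoliton.IsExpandingGradientSoliton g f)
    (W : ∀ x : M, TangentSpace (𝓡 n) x)
    (hW : ContMDiff (𝓡 n) (𝓡 n).tangent ∞ (fun x => (⟨x, W x⟩ : TangentBundle (𝓡 n) M)))
    -- `ΔW + D_X W - ½ W = 0` with `X = ∇f`
    (hWeq : ∀ e ∈ IsManifold.maximalAtlas (𝓡 n) ∞ M, ∀ y ∈ e.target, ∀ k : Fin n,
      RicciSoliton.laplacianVec (RicciSoliton.metricIn g e) (RicciSoliton.vecIn W e) y k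
        + RicciSoliton.covVecAlong (RicciSoliton.metricIn g e) (RicciSoliton.gradIn g f e)
            (RicciSoliton.vecIn W e) y k
        - (1 / 2 : ℝ) * RicciSoliton.vecIn W e y k = 0) :
    -- `Δ_L h + ℒ_X h - h = 0` with `h = ℒ_W g`
    ∀ e ∈ IsManifold.maximalAtlas (𝓡 n) ∞ M, ∀ y ∈ e.target, ∀ i k : Fin n,
      RicciSoliton.lichnerowicz (RicciSoliton.metricIn g e)
          (RicciSoliton.lieDeriv (RicciSoliton.vecIn W e) (RicciSoliton.metricIn g e)) y i k
        + RicciSoliton.lieDeriv (RicciSoliton.gradIn g f e)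
          (RicciSoliton.lieDeriv (RicciSoliton.vecIn W e) (RicciSoliton.metricIn g e)) y i k
        - RicciSoliton.lieDeriv (RicciSoliton.vecIn W e) (RicciSoliton.metricIn g e) y i k
        = 0 := by
  intro e he y hy i k
  exact (RicciSoliton.isMetricOn_metricIn g he).lichnerowicz_lieDeriv_eq_zero
    (RicciSoliton.contDiffOn_comp_symm hsol.1 he) (fun k => RicciSoliton.contDiffOn_vecIn hW he k)
    (hsol.2 e he) (hWeq e he) hy i k
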